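/- Languages are sets of natural numbers; a number $n\in\mathbb N$ is presented to a machine as its binary writing $a_1\cdots a_k$ (most significant bit first, with $0$ written as the word $0$). **Pointer machines.** Let $p\ge 1$ and $\Sigma=\{0,1,\star\}$. A non-deterministic pointer machine with $p$ pointers consists of a finite set $Q$ of states and a total relation $\rightarrow$ from the set $\Sigma^p\times Q$ of pseudo-configurations to $(\{+,-,\epsilon\}^p\times Q)\cup\{\mathbf{accept},\mathbf{reject}\}$; it is deterministic if $\rightarrow$ is functional. On input $n$, the word $\star a_1\cdots a_k$ is written on a circular tape with addresses $0,\dots,k$ taken modulo $k+1$, address $0$ holding $\star$. A configuration consists of the addresses of the $p$ pointers, one memory slot in $\Sigma$ for each pointer, and a state; the slots and the state form its pseudo-configuration. The computation starts with all pointers at address $0$ and in a chosen initial pseudo-configuration $s$ (whose slots need not agree with the tape). A transition depends only on the current pseudo-configuration; it either halts with $\mathbf{accept}$ or $\mathbf{reject}$, or gives a new state and moves each pointer one step forward ($+$), one step backward ($-$), or not at all ($\epsilon$). The slot of a pointer that moves is updated to the letter at its new address; the slot of a pointer that does not move is unchanged. The machine accepts $n$ from $s$ if after finitely many transitions every branch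 of the computation reaches $\mathbf{accept}$. It decides $S\subseteq\mathbb N$ if there is an $s$ such that for all $n\in\mathbb N$ it accepts $n$ from $s$ if and only if $n\in S$. Let $\mathbf{DPM}$ (resp. $\mathbf{NDPM}$) be the class of sets decided by deterministic (resp. non-deterministic) pointer machines with any number $p\ge1$ of pointers. **Logarithmic space.** $\mathbf L$ (resp. $\mathbf{NL}$) is the class of sets $S\subseteq\mathbb N$ accepted by a deterministic (resp. non-deterministic) Turing machine with a two-way read-only input tape, on which the binary writing of $n$ stands between endmarkers, and a read-write work tape, of which every branch of the computation visits at most $O(1+\log \ell)$ cells on inputs of length $\ell$; $n$ is accepted if some branch reaches an accepting state. $\mathbf{co\text{-}NL}$ is the class of complements $\mathbb N\setminus S$ of sets $S\in\mathbf{NL}$. **Corollary.** $\mathbf L\subseteq\mathbf{DPM}$ and $\mathbf{co\text{-}NL}\subseteq\mathbf{NDPM}$. -/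

import Mathlib

namespace PtrMach

/-- The binary writing of `n`, most significant bit first; `0` is written as the one-letter word
`0`. -/
def binary (n : ℕ) : List Bool :=
  if n = 0 then [false] else (Nat.bits n).reverse

/-- The three possible head or pointer instructions. -/
inductive Move : Type
  | fwd
  | bwd
  | stay

/-! ### Pointer machines -/

/-- The alphabet `{0, 1, ⋆}` of pointer machines. -/
inductive Sym : Type
  | zero
  | one
  | star

/-- The letter of a bit. -/
def Sym.ofBool : Bool → Sym
  | false => Sym.zero
  | true => Sym.one

/-- Pseudo-configurations of a machine with `p` pointers and state set `Q`: the last values read by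
the pointers (the memory slots) and the current state, without the addresses. -/
abbrev PseudoConfig (p : ℕ) (Q : Type) : Type := (Fin p → Sym) × Q

/-- The right-hand sides of transitions: one instruction for each pointer together with a new
state, or acceptance, or rejection. -/
inductive Outcome (p : ℕ) (Q : Type) : Type
  | move (d : Fin p → Move) (q : Q)
  | accept
  | reject

/-- Non-deterministic pointer machines with `p` pointers: a finite set of states and a total
transition relation. -/
structure Machine (p : ℕ) : Type 1 where
  Q : Type
  finite_states : Finite Q
  trans : PseudoConfig p Q → Outcome p Q → Prop
  total : ∀ c, ∃ o, trans c o

/-- A pointer machine is deterministic when its transition relation is functional. -/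
def Machine.Deterministic {p : ℕ} (M : Machine p) : Prop :=
  ∀ c o o', M.trans c o → M.trans c o' → o = o'

/-- The circular input tape `⋆ a₁ … a_k` of a word `w = a₁ … a_k`: address `0` holds `⋆` and address
`i` holds `a_i`. -/
def circularTape (w : List Bool) : Fin (w.length + 1) → Sym :=
  Fin.cases Sym.star (fun i => Sym.ofBool (w.get i))

/-- Effect of an instruction on an address. Addition and subtraction in `Fin (w.length + 1)` are
modulo `w.length + 1`, so that the tape is circular. -/
def Move.onAddress {k : ℕ} : Move → Fin (k + 1) → Fin (k + 1)
  | Move.fwd, a => a + 1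
  | Move.bwd, a => a - 1
  | Move.stay, a => a

/-- The content of a memory slot after an instruction: it is refreshed, with the value found at the
new address, only when the pointer moves. -/
def Move.onSlot (w : List Bool) : Move → Fin (w.length + 1) → Sym → Sym
  | Move.stay, _, v => v
  | m, a, _ => circularTape w (m.onAddress a)

/-- Full configurations on the input word `w`: the addresses of the pointers and the
pseudo-configuration. -/
structure Config (p : ℕ) (Q : Type) (w : List Bool) : Type where
  addr : Fin p → Fin (w.length + 1)
  pseudo : PseudoConfig p Q

/-- Perform the instructions `d` and enter the state `q`. -/
def Config.next {p : ℕ} {Q : Type} {w : List Bool} (C : Config p Q w) (d : Fin p → Move) (q : Q) :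
    Config p Q w where
  addr := fun i => (d i).onAddress (C.addr i)
  pseudo := (fun i => (d i).onSlot w (C.addr i) (C.pseudo.1 i), q)

/-- `M.AcceptsWithin t C`: every branch of the computation of `M` from `C` reaches `accept` after at
most `t` transitions. -/
def Machine.AcceptsWithin {p : ℕ} (M : Machine p) {w : List Bool} :
    ℕ → Config p M.Q w → Prop
  | 0, _ => False
  | t + 1, C => ∀ o, M.trans C.pseudo o →
      match o with
      | Outcome.accept => True
      | Outcome.reject => False
      | Outcome.move d q => M.AcceptsWithin t (C.next d q)

/-- `M` with initial pseudo-configuration `s` accepts the input `n`: started with all pointers at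
address `0` (the address of `⋆`) and in the pseudo-configuration `s`, after a finite number of
transitions every branch reaches `accept`. -/
def Machine.Accepts {p : ℕ} (M : Machine p) (s : PseudoConfig p M.Q) (n : ℕ) : Prop :=
  ∃ t, M.AcceptsWithin t (w := binary n) ⟨fun _ => 0, s⟩

/-- `M` decides `S`: for some initial pseudo-configuration, the accepted inputs are exactly the
elements of `S`. -/
def Machine.Decides {p : ℕ} (M : Machine p) (S : Set ℕ) : Prop :=
  ∃ s : PseudoConfig p M.Q, ∀ n, M.Accepts s n ↔ n ∈ S

/-- The languages decided by non-deterministic pointer machines with at least one pointer. -/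
def NDPM : Set (Set ℕ) :=
  {S | ∃ p, 0 < p ∧ ∃ M : Machine p, M.Decides S}

/-- The languages decided by deterministic pointer machines with at least one pointer. -/
def DPM : Set (Set ℕ) :=
  {S | ∃ p, 0 < p ∧ ∃ M : Machine p, M.Deterministic ∧ M.Decides S}

/-! ### Turing machines and logarithmic space -/

/-- Letters of the input tape of a Turing machine: the two endmarkers and the bits. -/
inductive InSym : Type
  | leftEnd
  | rightEnd
  | bit (b : Bool)

/-- The read-only input tape of a word `w`: the left endmarker at position `0`, the bits at positions
`1, …, w.length`, and the right endmarker at position `w.length + 1`. -/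
def inputTape (w : List Bool) : ℕ → InSym
  | 0 => InSym.leftEnd
  | i + 1 => match w[i]? with
    | some b => InSym.bit b
    | none => InSym.rightEnd

/-- Non-deterministic Turing machines with a two-way read-only input tape and a read-write work
tape. A transition reads the state, the input letter and the work letter, and gives a new state, the
letter written on the work tape, a move of the input head and a move of the work head. -/
structure TM : Type 1 where
  Q : Type
  finite_states : Finite Q
  Γ : Type
  finite_alphabet : Finite Γ
  blank : Γ
  start : Q
  accepting : Set Q
  δ : Q → InSym → Γ → Set (Q × Γ × Move × Move)

/-- A Turing machine is deterministic when at most one transition applies in each situation. -/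
def TM.Deterministic (M : TM) : Prop :=
  ∀ q a b, (M.δ q a b).Subsingleton

/-- Configurations of a Turing machine. The work tape is infinite to the right, with cells
`0, 1, 2, …`. -/
structure TM.Cfg (M : TM) : Type where
  state : M.Q
  inPos : ℕ
  work : ℕ → M.Γ
  workPos : ℕ

/-- Moves of the input head, which stays between the endmarkers. -/
def Move.onInput (w : List Bool) : Move → ℕ → ℕ
  | Move.fwd, i => min (i + 1) (w.length + 1)
  | Move.bwd, i => i - 1
  | Move.stay, i => i

/-- Moves of the work head; a move to the left from cell `0` leaves it there. -/
def Move.onWork : Move → ℕ → ℕ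
  | Move.fwd, i => i + 1
  | Move.bwd, i => i - 1
  | Move.stay, i => i

/-- Initial configuration: start state, the input head on the left endmarker, the work tape blank and
the work head on cell `0`. -/
def TM.init (M : TM) : M.Cfg := ⟨M.start, 0, fun _ => M.blank, 0⟩

/-- One step of computation on the input word `w`. -/
def TM.Step (M : TM) (w : List Bool) (C C' : M.Cfg) : Prop :=
  ∃ q b dIn dWork, (q, b, dIn, dWork) ∈ M.δ C.state (inputTape w C.inPos) (C.work C.workPos) ∧
    C' = ⟨q, Move.onInput w dIn C.inPos, Function.update C.work C.workPos b,
      Move.onWork dWork C.workPos⟩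

/-- `C` occurs in some branch of the computation of `M` on `w`. -/
def TM.Reachable (M : TM) (w : List Bool) (C : M.Cfg) : Prop :=
  Relation.ReflTransGen (M.Step w) M.init C

/-- `M` accepts the input `n`: some branch of its computation on the binary writing of `n` reaches an
accepting state. -/
def TM.Accepts (M : TM) (n : ℕ) : Prop :=
  ∃ C, M.Reachable (binary n) C ∧ C.state ∈ M.accepting

/-- `M` works in space `O(log ℓ)` on inputs of length `ℓ`: on every branch, only the first
`c * (log ℓ + 1)` cells of the work tape are ever visited. -/
def TM.LogSpace (M : TM) : Prop :=
  ∃ c : ℕ, ∀ n C, M.Reachable (binary n) C →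
    C.workPos < c * (Nat.log 2 (binary n).length + 1)

/-- The class `L` of deterministic logarithmic space. -/
def ClassL : Set (Set ℕ) :=
  {S | ∃ M : TM, M.Deterministic ∧ M.LogSpace ∧ ∀ n, M.Accepts n ↔ n ∈ S}

/-- The class `NL` of non-deterministic logarithmic space. -/
def ClassNL : Set (Set ℕ) :=
  {S | ∃ M : TM, M.LogSpace ∧ ∀ n, M.Accepts n ↔ n ∈ S}

/-- The class `co-NL` of complements of languages in `NL`. -/
def ClassCoNL : Set (Set ℕ) :=
  {S | Sᶜ ∈ ClassNL}

end PtrMach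

namespace PtrMach

/-! On an input of length `ℓ`, a pointer is a digit in base `ℓ + 1`: it moves cyclically through `ℓ
+ 1` addresses, and the letter `⋆` reveals address `0`. So `k` pointers form a counter below `(ℓ +
1) ^ k`, with zero test, increment and decrement. A work tape with `O(log ℓ)` visited cells has
polynomially many contents. It therefore fits in two such counters, which serve as stacks for the
cells to the left and to the right of the work head; the current letter stays in the finite control.
A third counter is scratch space for multiplying and dividing by the base of the stacks, and one
more pointer follows the input head.

A fourth counter is a clock that stops every branch after polynomially many steps. This loses
nothing, since a shortest path to an accepting configuration repeats no configuration and there are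
only polynomially many reachable ones (`TM.accepts_iff_acceptsIn`). The simulation thus ends on
every branch, with an outcome saying whether an accepting state was met (`Prog.wp_simulate`).

Acceptance by a pointer machine quantifies over all branches. Accepting on the outcome `false`
therefore means that no branch of the Turing machine accepts, which gives the inclusion for co-NL.
For a deterministic machine there is a single branch, and accepting on the outcome `true` gives the
inclusion for L.

The simulator is assembled from small programs by `bind` and `iter`. It is verified through weakest
preconditions that include termination (`wp_bind`, `wp_iter`) and turned into a machine at the end
(`accepts_iff`). -/

instance : Finite Move :=
  Finite.of_surjective (fun i : Fin 3 => ![Move.fwd, Move.bwd, Move.stay] i) fun m => by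
    cases m
    exacts [⟨0, rfl⟩, ⟨1, rfl⟩, ⟨2, rfl⟩]

instance : Finite Sym :=
  Finite.of_surjective (fun i : Fin 3 => ![Sym.zero, Sym.one, Sym.star] i) fun m => by
    cases m
    exacts [⟨0, rfl⟩, ⟨1, rfl⟩, ⟨2, rfl⟩]

/-! ### Programs for pointers -/

/-- The addresses of `p` pointers on the circular tape of `w`. -/
abbrev Mem (p : ℕ) (w : List Bool) : Type := Fin p → Fin (w.length + 1)

/-- The addresses after the instructions `d`. -/
def Mem.moved {p : ℕ} {w : List Bool} (m : Mem p w) (d : Fin p → Move) : Mem p w :=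
  fun i => (d i).onAddress (m i)

/-- The letters at the addresses of the pointers. -/
def Mem.letters {p : ℕ} {w : List Bool} (m : Mem p w) : Fin p → Sym :=
  fun i => circularTape w (m i)

/-- A program for `p` pointers with exits labelled by `α`: a finite non-deterministic control, where
each step either continues in a new control state or leaves through an exit. -/
structure Prog (p : ℕ) (α : Type) : Type 1 where
  Q : Type
  finite_states : Finite Q
  start : Q
  next : Q → (Fin p → Sym) → Set ((Fin p → Move) × (Q ⊕ α))
  nonempty_next : ∀ q s, (next q s).Nonempty

namespace Prog

variable {p : ℕ} {α β : Type} {w : List Bool}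

/-- Every branch of the program from control state `q` and addresses `m` leaves through an exit, with
`post` satisfied there. -/
inductive Must (G : Prog p α) (post : α → Mem p w → Prop) : G.Q → Mem p w → Prop
  | step (q : G.Q) (m : Mem p w)
      (hq : ∀ d q', (d, Sum.inl q') ∈ G.next q m.letters → Must G post q' (m.moved d))
      (ha : ∀ d a, (d, Sum.inr a) ∈ G.next q m.letters → post a (m.moved d)) : Must G post q m

theorem must_iff {G : Prog p α} {post : α → Mem p w → Prop} {q : G.Q} {m : Mem p w} :
    G.Must post q m ↔
      (∀ d q', (d, Sum.inl q') ∈ G.next q m.letters → G.Must post q' (m.moved d)) ∧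
      ∀ d a, (d, Sum.inr a) ∈ G.next q m.letters → post a (m.moved d) :=
  ⟨fun h => by cases h with | step _ _ hq ha => exact ⟨hq, ha⟩, fun h => .step _ _ h.1 h.2⟩

/-- The weakest precondition of a program. -/
def wp (G : Prog p α) (post : α → Mem p w → Prop) (m : Mem p w) : Prop :=
  G.Must post G.start m

/-- At most one step is possible in each situation. -/
def Det (G : Prog p α) : Prop := ∀ q s, (G.next q s).Subsingleton

/-- A single step followed by an exit. -/
def prim (f : (Fin p → Sym) → Set ((Fin p → Move) × α)) (hf : ∀ s, (f s).Nonempty) :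
    Prog p α where
  Q := Unit
  finite_states := inferInstance
  start := ()
  next _ s := (fun x => (x.1, Sum.inr x.2)) '' f s
  nonempty_next _ s := (hf s).image _

theorem wp_prim {f : (Fin p → Sym) → Set ((Fin p → Move) × α)} {hf : ∀ s, (f s).Nonempty}
    {post : α → Mem p w → Prop} {m : Mem p w} :
    (prim f hf).wp post m ↔ ∀ d a, (d, a) ∈ f m.letters → post a (m.moved d) := by
  rw [wp, must_iff]
  constructor
  · rintro ⟨-, h⟩ d a ha
    exact h d a ⟨_, ha, rfl⟩
  · intro h
    constructor
    · rintro d q' ⟨x, hx, he⟩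
      cases he
    · rintro d a ⟨x, hx, he⟩
      cases he
      exact h _ _ hx

theorem det_prim {f : (Fin p → Sym) → Set ((Fin p → Move) × α)} {hf : ∀ s, (f s).Nonempty}
    (h : ∀ s, (f s).Subsingleton) : (prim f hf).Det := fun _ s => (h s).image _

/-- Sequential composition. -/
def bind [Finite α] (G : Prog p α) (H : α → Prog p β) : Prog p β where
  Q := G.Q ⊕ (Σ a, (H a).Q)
  finite_states :=
    have := G.finite_states
    have := fun a => (H a).finite_states
    inferInstance
  start := Sum.inl G.start
  next q s := match q with
    | Sum.inl q => (fun x => (x.1, Sum.inl (x.2.map id fun a => ⟨a, (H a).start⟩))) '' G.next q s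
    | Sum.inr ⟨a, q⟩ => (fun x => (x.1, x.2.map (fun q => Sum.inr ⟨a, q⟩) id)) '' (H a).next q s
  nonempty_next q s := match q with
    | Sum.inl q => (G.nonempty_next q s).image _
    | Sum.inr ⟨a, q⟩ => ((H a).nonempty_next q s).image _

theorem det_bind [Finite α] {G : Prog p α} {H : α → Prog p β} (hG : G.Det)
    (hH : ∀ a, (H a).Det) : (G.bind H).Det
  | Sum.inl q, s => (hG q s).image _
  | Sum.inr ⟨a, q⟩, s => (hH a q s).image _

/-- The second phase never returns to the first, so from there on the two transition systems are the
same up to renaming of states. -/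
theorem must_bind_inr [Finite α] {G : Prog p α} {H : α → Prog p β} {post : β → Mem p w → Prop}
    {a : α} {q : (H a).Q} {m : Mem p w} :
    (G.bind H).Must post (Sum.inr ⟨a, q⟩) m ↔ (H a).Must post q m := by
  constructor
  · intro h
    obtain ⟨x, hx⟩ : ∃ x : (G.bind H).Q, x = Sum.inr ⟨a, q⟩ := ⟨_, rfl⟩
    rw [← hx] at h
    induction h generalizing q with
    | step x m _ ha ih =>
      subst hx
      refine .step _ _ (fun d q' hq' => ih d (Sum.inr ⟨a, q'⟩) ⟨_, hq', rfl⟩ rfl) fun d b hb => ?_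
      exact ha d b ⟨_, hb, rfl⟩
  · intro h
    induction h with
    | step q m _ ha ih =>
      refine .step _ _ ?_ ?_
      · rintro d q' ⟨⟨d', q'' | b⟩, hx, he⟩
        · cases he
          exact ih _ _ hx
        · cases he
      · rintro d b ⟨⟨d', q'' | b'⟩, hx, he⟩
        · cases he
        · cases he
          exact ha _ _ hx

theorem wp_bind [Finite α] {G : Prog p α} {H : α → Prog p β} {post : β → Mem p w → Prop}
    {m : Mem p w} : (G.bind H).wp post m ↔ G.wp (fun a m => (H a).wp post m) m := by
  show (G.bind H).Must post (Sum.inl G.start) m ↔ G.Must _ G.start m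
  generalize G.start = q
  constructor
  · intro h
    obtain ⟨x, hx⟩ : ∃ x : (G.bind H).Q, x = Sum.inl q := ⟨_, rfl⟩
    rw [← hx] at h
    induction h generalizing q with
    | step x m hq _ ih =>
      subst hx
      refine .step _ _ (fun d q' hq' => ih d (Sum.inl q') ⟨_, hq', rfl⟩ _ rfl) fun d a ha => ?_
      exact must_bind_inr.1 (hq d (Sum.inr ⟨a, (H a).start⟩) ⟨_, ha, rfl⟩)
  · intro h
    induction h with
    | step q m _ ha ih =>
      refine .step _ _ ?_ ?_
      · rintro d q' ⟨⟨d', q'' | a⟩, hx, he⟩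
        · cases he
          exact ih _ _ hx
        · cases he
          exact must_bind_inr.2 (ha _ _ hx)
      · rintro d b ⟨⟨d', q'' | a⟩, hx, he⟩ <;> cases he

/-- Iteration: an exit `inl a` restarts the body at `a`, an exit `inr b` leaves the loop. -/
def iter [Finite α] (f : α → Prog p (α ⊕ β)) (a : α) : Prog p β where
  Q := Σ a, (f a).Q
  finite_states :=
    have := fun a => (f a).finite_states
    inferInstance
  start := ⟨a, (f a).start⟩
  next q s := (fun x => (x.1, match x.2 with
    | Sum.inl q' => Sum.inl ⟨q.1, q'⟩
    | Sum.inr (Sum.inl a) => Sum.inl ⟨a, (f a).start⟩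
    | Sum.inr (Sum.inr b) => Sum.inr b)) '' (f q.1).next q.2 s
  nonempty_next q s := ((f q.1).nonempty_next q.2 s).image _

theorem det_iter [Finite α] {f : α → Prog p (α ⊕ β)} {a : α} (hf : ∀ a, (f a).Det) :
    (iter f a).Det := fun q s => (hf q.1 q.2 s).image _

/-- The initial label only determines the start state; states and transitions of the loop do not
depend on it. -/
theorem must_iter_congr [Finite α] {f : α → Prog p (α ⊕ β)} {a a' : α}
    {post : β → Mem p w → Prop} {q : (iter f a).Q} {m : Mem p w}
    (h : (iter f a).Must post q m) : (iter f a').Must post q m := by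
  induction h with
  | step q m _ ha ih => exact .step _ _ ih ha

/-- One unfolding of the loop. Since `Must` is inductive, termination has to come from the user of
this equation: below it is an induction on a counter or on the time left on the clock. -/
theorem wp_iter [Finite α] {f : α → Prog p (α ⊕ β)} {a : α} {post : β → Mem p w → Prop}
    {m : Mem p w} :
    (iter f a).wp post m ↔ (f a).wp (fun x m' => match x with
      | Sum.inl a' => (iter f a').wp post m'
      | Sum.inr b => post b m') m := by
  show (iter f a).Must post ⟨a, (f a).start⟩ m ↔ (f a).Must _ (f a).start m
  generalize (f a).start = q
  constructor
  · intro h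
    obtain ⟨x, hx⟩ : ∃ x : (iter f a).Q, x = ⟨a, q⟩ := ⟨_, rfl⟩
    rw [← hx] at h
    induction h generalizing q with
    | step x m hq ha ih =>
      subst hx
      refine .step _ _ (fun d q' hq' => ih d ⟨a, q'⟩ ⟨_, hq', rfl⟩ _ rfl) ?_
      rintro d (a' | b) hx
      · exact must_iter_congr (a := a) (hq d ⟨a', (f a').start⟩ ⟨_, hx, rfl⟩)
      · exact ha d b ⟨_, hx, rfl⟩
  · intro h
    induction h with
    | step q m _ ha ih =>
      refine .step _ _ ?_ ?_
      · rintro d q' ⟨⟨d', q'' | a' | b⟩, hx, he⟩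
        · cases he
          exact ih _ _ hx
        · cases he
          exact must_iter_congr (ha _ _ hx)
        · cases he
      · rintro d b ⟨⟨d', q'' | a' | b⟩, hx, he⟩
        · cases he
        · cases he
        · cases he
          exact ha _ _ hx

/-- A single deterministic step followed by an exit. -/
def act (g : (Fin p → Sym) → (Fin p → Move) × α) : Prog p α :=
  prim (fun s => {g s}) fun _ => Set.singleton_nonempty _

theorem wp_act {g : (Fin p → Sym) → (Fin p → Move) × α} {post : α → Mem p w → Prop}
    {m : Mem p w} :
    (act g).wp post m ↔ post (g m.letters).2 (m.moved (g m.letters).1) := by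
  rw [act, wp_prim]
  constructor
  · intro h
    exact h _ _ rfl
  · rintro h d a hda
    obtain rfl : d = (g m.letters).1 := congrArg Prod.fst hda
    obtain rfl : a = (g m.letters).2 := congrArg Prod.snd hda
    exact h

theorem det_act {g : (Fin p → Sym) → (Fin p → Move) × α} : (act g).Det :=
  det_prim fun _ => Set.subsingleton_singleton

/-- Do nothing and leave through the exit `a`. -/
def pure (a : α) : Prog p α := act fun _ => (fun _ => Move.stay, a)

theorem wp_pure {a : α} {post : α → Mem p w → Prop} {m : Mem p w} :
    (pure a).wp post m ↔ post a m := wp_act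

theorem det_pure {a : α} : (pure a : Prog p α).Det := det_act

/-- Test a property of the letters under the pointers. -/
def test (g : (Fin p → Sym) → α) : Prog p α := act fun s => (fun _ => Move.stay, g s)

theorem wp_test {g : (Fin p → Sym) → α} {post : α → Mem p w → Prop} {m : Mem p w} :
    (test g).wp post m ↔ post (g m.letters) m := wp_act

/-! ### From programs to machines -/

/-- The pointer machine that runs a program and accepts at the exits in `A`. -/
def toMachine (G : Prog p α) (A : Set α) : Machine p where
  Q := G.Q
  finite_states := G.finite_states
  trans c o := ∃ x ∈ G.next c.2 c.1, match x.2 with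
    | Sum.inl q => o = Outcome.move x.1 q
    | Sum.inr a => (a ∈ A → o = Outcome.accept) ∧ (a ∉ A → o = Outcome.reject)
  total c := by
    obtain ⟨⟨d, q | a⟩, hx⟩ := G.nonempty_next c.2 c.1
    · exact ⟨_, _, hx, rfl⟩
    · by_cases h : a ∈ A
      · exact ⟨Outcome.accept, _, hx, fun _ => rfl, fun h' => absurd h h'⟩
      · exact ⟨Outcome.reject, _, hx, fun h' => absurd h' h, fun _ => rfl⟩

theorem Det.toMachine {G : Prog p α} (hG : G.Det) (A : Set α) :
    (G.toMachine A).Deterministic := by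
  rintro c o o' ⟨x, hx, ho⟩ ⟨x', hx', ho'⟩
  obtain rfl := hG _ _ hx hx'
  obtain ⟨d, q | a⟩ := x
  · exact ho.trans ho'.symm
  · by_cases h : a ∈ A
    · exact (ho.1 h).trans (ho'.1 h).symm
    · exact (ho.2 h).trans (ho'.2 h).symm

end Prog

theorem Move.onSlot_circularTape (w : List Bool) (d : Move) (a : Fin (w.length + 1)) :
    d.onSlot w a (circularTape w a) = circularTape w (d.onAddress a) := by
  cases d <;> rfl

/-- The configuration with addresses `m`, slots agreeing with the tape, and state `q`. -/
def Mem.config {p : ℕ} {Q : Type} {w : List Bool} (m : Mem p w) (q : Q) : Config p Q w :=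
  ⟨m, m.letters, q⟩

/-- Agreement of the slots with the tape is an invariant: a moving pointer refreshes its slot, and a
resting one keeps a value that was already right. Hence programs may forget the slots and read the
tape directly. -/
theorem Mem.config_next {p : ℕ} {Q : Type} {w : List Bool} (m : Mem p w) (q q' : Q)
    (d : Fin p → Move) : (m.config q).next d q' = (m.moved d).config q' := by
  simp only [Mem.config, Config.next, Mem.letters, Move.onSlot_circularTape]
  rfl

theorem Machine.AcceptsWithin.mono {p : ℕ} {M : Machine p} {w : List Bool} {t t' : ℕ}
    (htt : t ≤ t') {C : Config p M.Q w} (h : M.AcceptsWithin t C) : M.AcceptsWithin t' C := by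
  induction t generalizing t' C with
  | zero => exact h.elim
  | succ t ih =>
    obtain ⟨t', rfl⟩ : ∃ u, t' = u + 1 := ⟨t' - 1, by omega⟩
    intro o ho
    have := h o ho
    cases o with
    | accept => trivial
    | reject => exact this
    | move d q => exact ih (by omega) this

/-- Branching is finite, so termination of every branch yields a uniform time bound, as in König's
lemma. -/
theorem Prog.exists_acceptsWithin_iff {p : ℕ} {α : Type} {w : List Bool} (G : Prog p α) (A : Set α)
    (q : G.Q) (m : Mem p w) :
    (∃ t, (G.toMachine A).AcceptsWithin t (m.config q)) ↔ G.Must (fun a _ => a ∈ A) q m := by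
  constructor
  · rintro ⟨t, h⟩
    induction t generalizing q m with
    | zero => exact h.elim
    | succ t ih =>
      refine .step _ _ (fun d q' hq' => ih _ _ ?_) fun d a ha => ?_
      · have := h (Outcome.move d q') ⟨_, hq', rfl⟩
        exact Mem.config_next m q q' d ▸ this
      · by_contra hA
        exact h Outcome.reject ⟨_, ha, fun h => absurd h hA, fun _ => rfl⟩
  · intro h
    induction h with
    | step q m hq ha ih =>
      have := G.finite_states
      -- Pairs that are not transitions get the default time `0`, so that a time is chosen for every
      -- pair and the maximum is over a finite type.
      have hb : ∀ x : (Fin p → Move) × G.Q, ∃ t, (x.1, Sum.inl x.2) ∈ G.next q m.letters →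
          (G.toMachine A).AcceptsWithin t ((m.moved x.1).config x.2) := fun x => by
        by_cases hx : (x.1, Sum.inl x.2) ∈ G.next q m.letters
        · exact (ih _ _ hx).imp fun _ h _ => h
        · exact ⟨0, fun h => absurd h hx⟩
      choose T hT using hb
      obtain ⟨t, ht⟩ := (Set.finite_range T).bddAbove
      refine ⟨t + 1, ?_⟩
      rintro o ⟨⟨d, q' | a⟩, hx, ho⟩
      · obtain rfl : o = Outcome.move d q' := ho
        have h := (hT (d, q') hx).mono (ht ⟨_, rfl⟩)
        exact (congrArg ((G.toMachine A).AcceptsWithin t) (Mem.config_next m q q' d)).mpr h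
      · obtain rfl : o = Outcome.accept := ho.1 (ha _ _ hx)
        trivial

/-- All pointers start at address `0`, so initial slots holding `⋆` agree with the tape and the
invariant holds from the beginning. -/
theorem Prog.accepts_iff {p : ℕ} {α : Type} (G : Prog p α) (A : Set α) (n : ℕ) :
    (G.toMachine A).Accepts (fun _ => Sym.star, G.start) n ↔
      G.wp (w := binary n) (fun a _ => a ∈ A) (fun _ => 0) :=
  G.exists_acceptsWithin_iff A G.start _

/-! ### Counters made of pointers -/

/-- No bit is written as `⋆`; this is what makes zero tests and carries detectable. -/
theorem circularTape_eq_star {w : List Bool} {a : Fin (w.length + 1)} :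
    circularTape w a = Sym.star ↔ a = 0 := by
  refine Fin.cases ?_ (fun i => ?_) a
  · simp [circularTape]
  · simp only [circularTape, Fin.cases_succ, Fin.succ_ne_zero, iff_false]
    cases w.get i <;> simp [Sym.ofBool]

/-- Whether a letter is `⋆`. -/
def Sym.isStar : Sym → Bool
  | Sym.star => true
  | _ => false

theorem isStar_circularTape {w : List Bool} {a : Fin (w.length + 1)} :
    (circularTape w a).isStar = true ↔ a = 0 := by
  rw [← circularTape_eq_star]
  cases circularTape w a <;> simp [Sym.isStar]

section Counter

variable {p : ℕ} {w : List Bool}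

/-- The instruction `d` for the pointer `i`, the other pointers being left in place. -/
def single (i : Fin p) (d : Move) : Fin p → Move := Function.update (fun _ => Move.stay) i d

theorem Mem.moved_single (m : Mem p w) (i : Fin p) (d : Move) :
    m.moved (single i d) = Function.update m i (d.onAddress (m i)) := by
  funext j
  by_cases h : j = i
  · subst h
    simp [Mem.moved, single]
  · simp [Mem.moved, single, h, Move.onAddress]

/-- The number written in base `w.length + 1` by a list of pointers, least significant digit
first. -/
def val : List (Fin p) → Mem p w → ℕ
  | [], _ => 0
  | i :: l, m => m i + (w.length + 1) * val l m

theorem val_congr {l : List (Fin p)} {m m' : Mem p w} (h : ∀ i ∈ l, m i = m' i) :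
    val l m = val l m' := by
  induction l with
  | nil => rfl
  | cons i l ih =>
    rw [val, val, h i (by simp), ih fun j hj => h j (by simp [hj])]

theorem val_update {l : List (Fin p)} {m : Mem p w} {i : Fin p} (hi : i ∉ l)
    (a : Fin (w.length + 1)) : val l (Function.update m i a) = val l m :=
  val_congr fun j hj => Function.update_of_ne (by rintro rfl; exact hi hj) _ _

theorem val_lt (l : List (Fin p)) (m : Mem p w) : val l m < (w.length + 1) ^ l.length := by
  induction l with
  | nil => simp [val]
  | cons i l ih =>
    rw [val, List.length_cons, pow_succ']
    calc _ < (w.length + 1) + (w.length + 1) * val l m := by have := (m i).isLt; omega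
      _ = (w.length + 1) * (val l m + 1) := by ring
      _ ≤ _ := Nat.mul_le_mul_left _ ih

theorem val_eq_zero {l : List (Fin p)} {m : Mem p w} : val l m = 0 ↔ ∀ i ∈ l, m i = 0 := by
  induction l with
  | nil => simp [val]
  | cons i l ih => simp [val, ih]

/-- The addresses after adding one to a counter. -/
def incMem : List (Fin p) → Mem p w → Mem p w
  | [], m => m
  | i :: l, m => if m i + 1 = 0 then incMem l (Function.update m i (m i + 1))
    else Function.update m i (m i + 1)

theorem incMem_of_notMem {l : List (Fin p)} {m : Mem p w} {j : Fin p} (hj : j ∉ l) :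
    incMem l m j = m j := by
  induction l generalizing m with
  | nil => rfl
  | cons i l ih =>
    simp only [List.mem_cons, not_or] at hj
    rw [incMem]
    split_ifs
    · rw [ih hj.2, Function.update_of_ne hj.1]
    · rw [Function.update_of_ne hj.1]

/-- A carry occurs exactly when a pointer comes back to `⋆`. The modulus matters: the clock
recognizes its overflow by the return to zero. -/
theorem val_incMem {l : List (Fin p)} (hl : l.Nodup) (m : Mem p w) :
    val l (incMem l m) = (val l m + 1) % (w.length + 1) ^ l.length := by
  induction l generalizing m with
  | nil => simp [val]
  | cons i l ih =>
    obtain ⟨hi, hl⟩ := List.nodup_cons.1 hl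
    have hlt := val_lt l m
    have hm := (m i).isLt
    rw [incMem]
    split_ifs with h
    · have hv : (m i).val = w.length := by
        by_contra hne
        have := Fin.val_add_one_of_lt (i := m i) (Fin.lt_def.2 (by simp; omega))
        rw [h] at this
        simp at this
      rw [val, ih hl, incMem_of_notMem hi, Function.update_self, h, val_update hi, val, hv,
        List.length_cons, pow_succ']
      rw [show w.length + (w.length + 1) * val l m + 1 = (w.length + 1) * (val l m + 1) by ring,
        Nat.mul_mod_mul_left]
      simp
    · have hv : (m i).val < w.length := by
        by_contra hne
        apply h
        have : m i = Fin.last _ := Fin.ext (by simp; omega)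
        rw [this, Fin.last_add_one]
      rw [val, Function.update_self, val_update hi, val, List.length_cons,
        Fin.val_add_one_of_lt (Fin.lt_def.2 (by simpa using hv)), Nat.mod_eq_of_lt]
      · ring
      -- Without a carry, the new value is again that of a tuple of digits, hence below the modulus.
      · have := val_lt (i :: l) (Function.update m i (m i + 1))
        rw [val, Function.update_self, val_update hi, List.length_cons,
          Fin.val_add_one_of_lt (Fin.lt_def.2 (by simpa using hv))] at this
        linarith

/-- The addresses after subtracting one from a positive counter. -/
def decMem : List (Fin p) → Mem p w → Mem p w
  | [], m => m
  | i :: l, m => if m i = 0 then decMem l (Function.update m i (m i - 1))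
    else Function.update m i (m i - 1)

theorem decMem_of_notMem {l : List (Fin p)} {m : Mem p w} {j : Fin p} (hj : j ∉ l) :
    decMem l m j = m j := by
  induction l generalizing m with
  | nil => rfl
  | cons i l ih =>
    simp only [List.mem_cons, not_or] at hj
    rw [decMem]
    split_ifs
    · rw [ih hj.2, Function.update_of_ne hj.1]
    · rw [Function.update_of_ne hj.1]

theorem val_decMem {l : List (Fin p)} (hl : l.Nodup) {m : Mem p w} (hm : val l m ≠ 0) :
    val l (decMem l m) + 1 = val l m := by
  induction l generalizing m with
  | nil => simp [val] at hm
  | cons i l ih =>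
    obtain ⟨hi, hl⟩ := List.nodup_cons.1 hl
    have hlast : (0 : Fin (w.length + 1)) - 1 = Fin.last _ := by
      rw [sub_eq_iff_eq_add, Fin.last_add_one]
    rw [decMem]
    split_ifs with h
    · have hv : val l m ≠ 0 := by
        rintro hv
        simp [val, h, hv] at hm
      have := ih hl (m := Function.update m i (m i - 1)) (by rwa [val_update hi])
      rw [val_update hi] at this
      rw [val, decMem_of_notMem hi, Function.update_self, val, h, ← this, h, hlast,
        Fin.val_last, Fin.val_zero]
      ring
    · have hpos : 0 < (m i).val := Nat.pos_of_ne_zero fun h0 => h (Fin.ext h0)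
      rw [val, Function.update_self, val_update hi, val, Fin.val_sub_one_of_ne_zero h]
      omega

namespace Prog

/-- Move one pointer. -/
def move (i : Fin p) (d : Move) : Prog p Unit := act fun _ => (single i d, ())

theorem wp_move {i : Fin p} {d : Move} {post : Unit → Mem p w → Prop} {m : Mem p w} :
    (move i d).wp post m ↔ post () (Function.update m i (d.onAddress (m i))) := by
  rw [move, wp_act, Mem.moved_single]

/-- Test whether the pointer `i` is at address `0`. -/
def atStar (i : Fin p) : Prog p Bool := test fun s => (s i).isStar

theorem wp_atStar {i : Fin p} {post : Bool → Mem p w → Prop} {m : Mem p w} :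
    (atStar i).wp post m ↔ post (decide (m i = 0)) m := by
  rw [atStar, wp_test]
  have : (m.letters i).isStar = decide (m i = 0) := by
    rw [Bool.eq_iff_iff, Mem.letters, isStar_circularTape, decide_eq_true_iff]
  rw [this]

/-- Add one to a counter. -/
def inc : List (Fin p) → Prog p Unit
  | [] => pure ()
  | i :: l => (move i Move.fwd).bind fun _ => (atStar i).bind fun b => bif b then inc l else pure ()

theorem wp_inc {l : List (Fin p)} {post : Unit → Mem p w → Prop} {m : Mem p w} :
    (inc l).wp post m ↔ post () (incMem l m) := by
  induction l generalizing m with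
  | nil => exact wp_pure
  | cons i l ih =>
    rw [inc, wp_bind, wp_move, wp_bind, wp_atStar, Function.update_self, incMem]
    by_cases h : m i + 1 = 0
    · simp [Move.onAddress, h, ih]
    · simp [Move.onAddress, h, wp_pure]

theorem det_inc {l : List (Fin p)} : (inc l).Det := by
  induction l with
  | nil => exact det_pure
  | cons i l ih =>
    refine det_bind det_act fun _ => det_bind det_act fun b => ?_
    cases b
    exacts [det_pure, ih]

/-- Subtract one from a positive counter. -/
def dec : List (Fin p) → Prog p Unit
  | [] => pure ()
  | i :: l => (atStar i).bind fun b => (move i Move.bwd).bind fun _ => bif b then dec l else pure ()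

theorem wp_dec {l : List (Fin p)} {post : Unit → Mem p w → Prop} {m : Mem p w} :
    (dec l).wp post m ↔ post () (decMem l m) := by
  induction l generalizing m with
  | nil => exact wp_pure
  | cons i l ih =>
    rw [dec, wp_bind, wp_atStar, wp_bind, wp_move, decMem]
    by_cases h : m i = 0
    · simp [Move.onAddress, h, ih]
    · simp [Move.onAddress, h, wp_pure]

theorem det_dec {l : List (Fin p)} : (dec l).Det := by
  induction l with
  | nil => exact det_pure
  | cons i l ih =>
    refine det_bind det_act fun b => det_bind det_act fun _ => ?_
    cases b
    exacts [det_pure, ih]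

/-- Test whether a counter is zero. -/
def isZero (l : List (Fin p)) : Prog p Bool := test fun s => l.all fun i => (s i).isStar

theorem wp_isZero {l : List (Fin p)} {post : Bool → Mem p w → Prop} {m : Mem p w} :
    (isZero l).wp post m ↔ post (decide (val l m = 0)) m := by
  rw [isZero, wp_test]
  have : (l.all fun i => (m.letters i).isStar) = decide (val l m = 0) := by
    rw [Bool.eq_iff_iff, List.all_eq_true, decide_eq_true_iff, val_eq_zero]
    simp only [Mem.letters, isStar_circularTape]
  rw [this]

end Prog

end Counter

/-! ### A head and four registers -/

/-- The pointers of the register `j`. -/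
def regList (k : ℕ) (j : Fin 4) : List (Fin (4 * k + 1)) :=
  (List.finRange k).map fun i => (finProdFinEquiv (j, i)).succ

theorem nodup_regList (k : ℕ) (j : Fin 4) : (regList k j).Nodup :=
  (List.nodup_finRange k).map fun a b h => by simpa using h

theorem zero_notMem_regList (k : ℕ) (j : Fin 4) : 0 ∉ regList k j := by
  simp [regList, Fin.succ_ne_zero]

theorem notMem_regList {k : ℕ} {j j' : Fin 4} (hj : j' ≠ j) {i : Fin (4 * k + 1)}
    (hi : i ∈ regList k j') : i ∉ regList k j := by
  simp only [regList, List.mem_map] at hi ⊢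
  rintro ⟨b, -, hb⟩
  obtain ⟨a, -, rfl⟩ := hi
  have := finProdFinEquiv.injective (Fin.succ_injective _ hb)
  simp only [Prod.mk.injEq] at this
  exact hj this.1.symm

@[simp]
theorem length_regList (k : ℕ) (j : Fin 4) : (regList k j).length = k := by simp [regList]

/-- What the addresses of `4 * k + 1` pointers stand for: an input head and four registers. -/
@[ext]
structure View (w : List Bool) : Type where
  head : Fin (w.length + 1)
  reg : Fin 4 → ℕ

/-- Change the value of a register. -/
def View.set {w : List Bool} (v : View w) (j : Fin 4) (x : ℕ) : View w :=
  ⟨v.head, Function.update v.reg j x⟩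

/-- The head and the registers given by the addresses of the pointers. -/
def Mem.view {k : ℕ} {w : List Bool} (m : Mem (4 * k + 1) w) : View w :=
  ⟨m 0, fun j => val (regList k j) m⟩

section Registers

variable {k : ℕ} {w : List Bool}

theorem Mem.view_reg_lt (m : Mem (4 * k + 1) w) (j : Fin 4) :
    m.view.reg j < (w.length + 1) ^ k := by
  have := val_lt (regList k j) m
  rwa [length_regList] at this

theorem view_incMem (m : Mem (4 * k + 1) w) (j : Fin 4) :
    Mem.view (incMem (regList k j) m) =
      m.view.set j ((m.view.reg j + 1) % (w.length + 1) ^ k) := by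
  refine View.ext (incMem_of_notMem (zero_notMem_regList k j)) (funext fun j' => ?_)
  by_cases h : j' = j
  · subst h
    simp [Mem.view, View.set, val_incMem (nodup_regList k j')]
  · simp only [Mem.view, View.set, Function.update_of_ne h]
    exact val_congr fun i hi => incMem_of_notMem (notMem_regList h hi)

theorem view_decMem (m : Mem (4 * k + 1) w) (j : Fin 4) (hj : m.view.reg j ≠ 0) :
    Mem.view (decMem (regList k j) m) = m.view.set j (m.view.reg j - 1) := by
  refine View.ext (decMem_of_notMem (zero_notMem_regList k j)) (funext fun j' => ?_)
  by_cases h : j' = j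
  · subst h
    have := val_decMem (nodup_regList k j') hj
    simp only [Mem.view, View.set, Function.update_self]
    omega
  · simp only [Mem.view, View.set, Function.update_of_ne h]
    exact val_congr fun i hi => decMem_of_notMem (notMem_regList h hi)

theorem view_update_head (m : Mem (4 * k + 1) w) (a : Fin (w.length + 1)) :
    Mem.view (Function.update m 0 a : Mem (4 * k + 1) w) = ⟨a, m.view.reg⟩ := by
  refine View.ext (by simp [Mem.view]) (funext fun j => ?_)
  exact val_update (zero_notMem_regList k j) a

namespace Prog

variable {α β : Type}

/-- From the addresses `m`, the program always leaves through the exit `a` with the addresses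
`m'`. -/
def Runs {p : ℕ} (G : Prog p α) (m : Mem p w) (a : α) (m' : Mem p w) : Prop :=
  ∀ post : α → Mem p w → Prop, G.wp post m ↔ post a m'

theorem Runs.bind {p : ℕ} [Finite α] {G : Prog p α} {H : α → Prog p β} {m m' m'' : Mem p w} {a : α}
    {b : β} (hG : G.Runs m a m') (hH : (H a).Runs m' b m'') : (G.bind H).Runs m b m'' :=
  fun post => by rw [wp_bind, hG, hH]

theorem runs_pure {p : ℕ} {a : α} {m : Mem p w} : (pure a).Runs m a m := fun _ => wp_pure

/-- On the head and the registers, the program computes the function `f`. -/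
def Computes (w : List Bool) (G : Prog (4 * k + 1) α) (f : View w → α × View w) : Prop :=
  ∀ m : Mem (4 * k + 1) w, ∃ m' : Mem (4 * k + 1) w, m'.view = (f m.view).2 ∧
    G.Runs m (f m.view).1 m'

theorem Computes.bind [Finite α] {G : Prog (4 * k + 1) α} {H : α → Prog (4 * k + 1) β}
    {f : View w → α × View w} {g : α → View w → β × View w} (hG : G.Computes w f)
    (hH : ∀ a, (H a).Computes w (g a)) :
    (G.bind H).Computes w fun v => g (f v).1 (f v).2 := fun m => by
  obtain ⟨m₁, hv₁, h₁⟩ := hG m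
  obtain ⟨m₂, hv₂, h₂⟩ := hH (f m.view).1 m₁
  rw [hv₁] at h₂ hv₂
  exact ⟨m₂, hv₂, h₁.bind h₂⟩

theorem computes_inc (j : Fin 4) :
    (inc (regList k j)).Computes w fun v =>
      ((), v.set j ((v.reg j + 1) % (w.length + 1) ^ k)) :=
  fun m => ⟨_, view_incMem m j, fun _ => wp_inc⟩

/-- Add `n` to a register. -/
def add (k : ℕ) (j : Fin 4) : ℕ → Prog (4 * k + 1) Unit
  | 0 => pure ()
  | n + 1 => (add k j n).bind fun _ => inc (regList k j)

theorem det_add (j : Fin 4) (n : ℕ) : (add k j n).Det := by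
  induction n with
  | zero => exact det_pure
  | succ n ih => exact det_bind ih fun _ => det_inc

theorem computes_add (j : Fin 4) (n : ℕ) :
    (add k j n).Computes w fun v => ((), v.set j ((v.reg j + n) % (w.length + 1) ^ k)) := by
  induction n with
  | zero =>
    refine fun m => ⟨m, ?_, fun _ => wp_pure⟩
    simp [Nat.mod_eq_of_lt (m.view_reg_lt j), View.set]
  | succ n ih =>
    intro m
    obtain ⟨m', hv, h⟩ := ih.bind (fun _ => computes_inc j) m
    exact ⟨m', by simp [hv, View.set, add_assoc], h⟩

/-- Run a finite transducer `x` times: the last state and the sum of the outputs. -/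
def transduce (f : α → α × ℕ) : ℕ → α → α × ℕ
  | 0, a => (a, 0)
  | x + 1, a => ((transduce f x (f a).1).1, (f a).2 + (transduce f x (f a).1).2)

/-- Count the register `i` down to zero, adding to the register `j` the outputs of a finite
transducer. -/
def transfer [Finite α] (k : ℕ) (i j : Fin 4) (f : α → α × ℕ) : α → Prog (4 * k + 1) α :=
  iter fun a => (isZero (regList k i)).bind fun z => bif z then pure (Sum.inr a) else
    (dec (regList k i)).bind fun _ => (add k j (f a).2).bind fun _ => pure (Sum.inl (f a).1)

theorem det_transfer [Finite α] (i j : Fin 4) (f : α → α × ℕ) (a : α) :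
    (transfer k i j f a).Det := by
  refine det_iter fun a => det_bind det_act fun z => ?_
  cases z
  · exact det_bind det_dec fun _ => det_bind (det_add _ _) fun _ => det_pure
  · exact det_pure

/-- Induction on the content of the register `i`, which drops by one in each round. Different
transducers turn this single loop into copying, multiplication by a constant, and division with
remainder. -/
theorem computes_transfer [Finite α] {i j : Fin 4} (hij : i ≠ j) (f : α → α × ℕ) (a : α) :
    (transfer k i j f a).Computes w fun v =>
      ((transduce f (v.reg i) a).1,
        (v.set i 0).set j ((v.reg j + (transduce f (v.reg i) a).2) % (w.length + 1) ^ k)) := by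
  intro m
  generalize hx : m.view.reg i = x
  induction x generalizing m a with
  | zero =>
    have ht : transduce f (m.view.reg i) a = (a, 0) := by rw [hx, transduce]
    have hu : Function.update m.view.reg i 0 = m.view.reg := by rw [← hx, Function.update_eq_self]
    refine ⟨m, ?_, fun post => ?_⟩
    · simp [View.set, ht, hu, Nat.mod_eq_of_lt (m.view_reg_lt j)]
    · have hi : val (regList k i) m = 0 := hx
      rw [transfer, wp_iter, wp_bind, wp_isZero, decide_eq_true hi, cond_true, wp_pure]
      simp only [ht]
  | succ x ih =>
    have hi : val (regList k i) m ≠ 0 := by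
      rw [show val (regList k i) m = x + 1 from hx]
      simp
    have hv₁ := view_decMem m i hi
    rw [hx, Nat.add_sub_cancel] at hv₁
    obtain ⟨m₂, hv₂, h₂⟩ := computes_add (w := w) j (f a).2 (decMem (regList k i) m)
    have hi₂ : m₂.view.reg i = x := by simp [hv₂, hv₁, View.set, hij]
    obtain ⟨m₃, hv₃, h₃⟩ := ih (f a).1 m₂ hi₂
    have ht : transduce f (m.view.reg i) a =
        ((transduce f x (f a).1).1, (f a).2 + (transduce f x (f a).1).2) := by rw [hx, transduce]
    dsimp only at hv₃ h₃
    rw [hi₂] at hv₃ h₃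
    refine ⟨m₃, ?_, fun post => ?_⟩
    · rw [hv₃, hv₂, hv₁]
      ext j'
      · rfl
      · by_cases hj : j' = j
        · subst hj
          simp [View.set, ht, add_assoc, Function.update_of_ne hij.symm]
        · simp only [View.set, Function.update_of_ne hj]
          by_cases hj' : j' = i
          · simp [hj']
          · simp [hj, hj']
    · rw [transfer, wp_iter, wp_bind, wp_isZero, decide_eq_false hi, cond_false, wp_bind,
        wp_dec, wp_bind, h₂, wp_pure]
      simp only [ht]
      exact h₃ post

end Prog

end Registers

/-! ### Stacks in registers -/

namespace Prog

variable {k : ℕ} {w : List Bool}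

theorem transduce_const (c x : ℕ) :
    transduce (fun _ : Unit => ((), c)) x () = ((), c * x) := by
  induction x with
  | zero => rfl
  | succ x ih => simp [transduce, ih, mul_add, add_comm]

/-- Multiply the register `j` by `b` and add `a`, with the help of the register `2`. -/
def push (k : ℕ) (j : Fin 4) (b a : ℕ) : Prog (4 * k + 1) Unit :=
  (transfer k j 2 (fun _ : Unit => ((), b)) ()).bind fun _ =>
    (add k 2 a).bind fun _ => transfer k 2 j (fun _ : Unit => ((), 1)) ()

theorem det_push (j : Fin 4) (b a : ℕ) : (push k j b a).Det :=
  det_bind (det_transfer _ _ _ _) fun _ => det_bind (det_add _ _) fun _ => det_transfer _ _ _ _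

theorem runs_push {j : Fin 4} (hj : j ≠ 2) (b a : ℕ) {m : Mem (4 * k + 1) w}
    (hm : m.view.reg 2 = 0) (hN : b * m.view.reg j + a < (w.length + 1) ^ k) :
    ∃ m' : Mem (4 * k + 1) w, m'.view = m.view.set j (b * m.view.reg j + a) ∧
      (push k j b a).Runs m () m' := by
  obtain ⟨m', hv, h⟩ := ((computes_transfer hj (fun _ : Unit => ((), b)) ()).bind fun _ =>
    (computes_add 2 a).bind fun _ =>
      computes_transfer (Ne.symm hj) (fun _ : Unit => ((), 1)) ()) m
  refine ⟨m', ?_, h⟩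
  rw [hv]
  ext j'
  · rfl
  · by_cases h2 : j' = j
    · subst h2
      simp [View.set, transduce_const, hm, Nat.mod_eq_of_lt hN, hj]
    · by_cases h3 : j' = 2
      · subst h3
        simp [View.set, h2, hm]
      · simp [View.set, h2, h3]

/-- One step of counting modulo `b + 1`, with a carry. -/
def countMod (b : ℕ) (r : Fin (b + 1)) : Fin (b + 1) × ℕ :=
  (r + 1, if r + 1 = 0 then 1 else 0)

/-- The state of the transducer is the running remainder, and each wrap-around contributes one to
the quotient. -/
theorem transduce_countMod (b x : ℕ) (r : Fin (b + 1)) :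
    ((transduce (countMod b) x r).1 : ℕ) = (r + x) % (b + 1) ∧
      (transduce (countMod b) x r).2 = (r + x) / (b + 1) := by
  induction x generalizing r with
  | zero => simp [transduce, Nat.mod_eq_of_lt r.isLt, Nat.div_eq_of_lt r.isLt]
  | succ x ih =>
    obtain ⟨h₁, h₂⟩ := ih (r + 1)
    have hr := r.isLt
    by_cases hlast : r.val = b
    · have h0 : r + 1 = 0 := by
        rw [show r = Fin.last b from Fin.ext hlast, Fin.last_add_one]
      rw [h0] at h₁ h₂
      have he : r.val + (x + 1) = x + (b + 1) := by omega
      simp only [transduce, countMod, h0, if_true, he, Nat.add_mod_right,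
        Nat.add_div_right x (Nat.succ_pos b)] at h₁ h₂ ⊢
      refine ⟨by simpa using h₁, ?_⟩
      rw [add_comm]
      simpa using h₂
    · have hv : (r + 1).val = r.val + 1 :=
        Fin.val_add_one_of_lt (Fin.lt_def.2 (by simp; omega))
      have h0 : r + 1 ≠ 0 := fun h => by simp [h] at hv
      have he : r.val + (x + 1) = r.val + 1 + x := by omega
      rw [hv] at h₁ h₂
      simp only [transduce, countMod, h0, if_false, he, zero_add]
      exact ⟨h₁, h₂⟩

/-- Divide the register `j` by `b + 1`, with the help of the register `2`, and return the
remainder. -/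
def pop (k : ℕ) (j : Fin 4) (b : ℕ) : Prog (4 * k + 1) (Fin (b + 1)) :=
  (transfer k j 2 (countMod b) 0).bind fun r =>
    (transfer k 2 j (fun _ : Unit => ((), 1)) ()).bind fun _ => pure r

theorem det_pop (j : Fin 4) (b : ℕ) : (pop k j b).Det :=
  det_bind (det_transfer _ _ _ _) fun _ => det_bind (det_transfer _ _ _ _) fun _ => det_pure

theorem runs_pop {j : Fin 4} (hj : j ≠ 2) (b : ℕ) {m : Mem (4 * k + 1) w}
    (hm : m.view.reg 2 = 0) :
    ∃ (m' : Mem (4 * k + 1) w) (r : Fin (b + 1)),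
      m'.view = m.view.set j (m.view.reg j / (b + 1)) ∧ r.val = m.view.reg j % (b + 1) ∧
      (pop k j b).Runs m r m' := by
  obtain ⟨m₁, hv₁, h₁⟩ := computes_transfer (w := w) hj (countMod b) 0 m
  obtain ⟨m₂, hv₂, h₂⟩ :=
    computes_transfer (w := w) (Ne.symm hj) (fun _ : Unit => ((), 1)) () m₁
  obtain ⟨ht₁, ht₂⟩ := transduce_countMod b (m.view.reg j) 0
  refine ⟨m₂, _, ?_, ?_, h₁.bind (h₂.bind runs_pure)⟩
  · have hN : m.view.reg j / (b + 1) < (w.length + 1) ^ k :=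
      (Nat.div_le_self _ _).trans_lt (m.view_reg_lt j)
    rw [hv₂, hv₁]
    ext j'
    · rfl
    · by_cases h2 : j' = j
      · subst h2
        simp [View.set, transduce_const, hm, ht₂, Nat.mod_eq_of_lt hN, hj]
      · by_cases h3 : j' = 2
        · subst h3
          simp [View.set, h2, hm]
        · simp [View.set, h2, h3]
  · simpa using ht₁

end Prog

/-! ### The work tape -/

section Work

variable {Γ : Type} {k : ℕ} {w : List Bool}

/-- A numbering of the letters by `1, …, b`, with all other numbers read as blanks. -/
structure Coding (Γ : Type) (blank : Γ) (b : ℕ) where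
  code : Γ → ℕ
  decode : ℕ → Γ
  code_pos : ∀ g, 0 < code g
  code_le : ∀ g, code g ≤ b
  decode_code : ∀ g, decode (code g) = g
  decode_zero : decode 0 = blank

theorem exists_coding (Γ : Type) [Finite Γ] (blank : Γ) {b : ℕ} (hb : Nat.card Γ ≤ b) :
    Nonempty (Coding Γ blank b) := by
  let f := Finite.equivFin Γ
  have hf : Function.Injective fun g => (f g).val + 1 := fun g g' h => by
    simpa [Fin.val_inj] using h
  exact ⟨{
    code := fun g => (f g).val + 1
    decode := Function.extend (fun g => (f g).val + 1) id fun _ => blank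
    code_pos := fun g => Nat.succ_pos _
    code_le := fun g => (f g).isLt.trans_le hb
    decode_code := fun g => hf.extend_apply _ _ g
    decode_zero := Function.extend_apply' _ _ _ (by simp) }⟩

variable {blank : Γ} {b : ℕ}

/-- The number whose digits are the codes of the letters to the left of a position. -/
def Coding.left (c : Coding Γ blank b) (work : ℕ → Γ) : ℕ → ℕ
  | 0 => 0
  | i + 1 => (b + 1) * c.left work i + c.code (work i)

theorem Coding.left_congr (c : Coding Γ blank b) {work work' : ℕ → Γ} {i : ℕ}
    (h : ∀ j < i, work j = work' j) : c.left work i = c.left work' i := by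
  induction i with
  | zero => rfl
  | succ i ih => rw [left, left, ih fun j hj => h j (by omega), h i (by omega)]

/-- The codes are digits in base `b + 1`. This bound keeps a push on the left stack from overflowing
its register. -/
theorem Coding.left_lt (c : Coding Γ blank b) (work : ℕ → Γ) (i : ℕ) :
    c.left work i < (b + 1) ^ i := by
  induction i with
  | zero => simp [left]
  | succ i ih =>
    have := c.code_le (work i)
    rw [left, pow_succ']
    calc _ < (b + 1) * c.left work i + (b + 1) := by omega
      _ = (b + 1) * (c.left work i + 1) := by ring
      _ ≤ _ := Nat.mul_le_mul_left _ ih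

/-- The registers `0` and `1` and the current letter `g` represent the first `s` cells of a work tape
with the head at `pos`; the auxiliary register `2` is zero. -/
structure WorkRep (c : Coding Γ blank b) (s : ℕ) (r : Fin 4 → ℕ) (g : Γ) (work : ℕ → Γ)
    (pos : ℕ) : Prop where
  aux : r 2 = 0
  cur : work pos = g
  left : r 0 = c.left work pos
  right_lt : r 1 < (b + 1) ^ (s - 1 - pos)
  right : ∀ i, c.decode (r 1 / (b + 1) ^ i % (b + 1)) = work (pos + 1 + i)

/-- The current cell belongs to neither stack, so writing changes only the letter kept in the
control. -/
theorem WorkRep.write {c : Coding Γ blank b} {s : ℕ} {r : Fin 4 → ℕ} {g : Γ} {work : ℕ → Γ}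
    {pos : ℕ} (h : WorkRep c s r g work pos) (g' : Γ) :
    WorkRep c s r g' (Function.update work pos g') pos where
  aux := h.aux
  cur := Function.update_self ..
  left := by
    rw [h.left]
    exact c.left_congr fun j hj => (Function.update_of_ne hj.ne _ _).symm
  right_lt := h.right_lt
  right i := by rw [h.right, Function.update_of_ne (by omega)]

namespace Prog

/-- Move the work head, starting with the letter `g` in the current cell, and return the letter in
the new cell. -/
def moveWork (k : ℕ) (c : Coding Γ blank b) (d : Move) (g : Γ) : Prog (4 * k + 1) Γ :=
  match d with
  | Move.stay => pure g
  | Move.fwd => (push k 0 (b + 1) (c.code g)).bind fun _ =>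
      (pop k 1 b).bind fun r => pure (c.decode r)
  | Move.bwd => (isZero (regList k 0)).bind fun z => bif z then pure g else
      (push k 1 (b + 1) (c.code g)).bind fun _ => (pop k 0 b).bind fun r => pure (c.decode r)

theorem det_moveWork (c : Coding Γ blank b) (d : Move) (g : Γ) : (moveWork k c d g).Det := by
  cases d with
  | stay => exact det_pure
  | fwd => exact det_bind (det_push _ _ _) fun _ => det_bind (det_pop _ _) fun _ => det_pure
  | bwd =>
    refine det_bind det_act fun z => ?_
    cases z
    · exact det_bind (det_push _ _ _) fun _ => det_bind (det_pop _ _) fun _ => det_pure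
    · exact det_pure

/-- A move of the work head pushes the current letter on the stack it leaves behind and pops the
next one from the other stack. Popping an empty right stack gives the digit `0`, which decodes to a
blank. The bound `s` on the positions limits the number of digits, so nothing is lost modulo
`(w.length + 1) ^ k`. -/
theorem runs_moveWork {c : Coding Γ blank b} {s : ℕ} (hs : (b + 1) ^ s ≤ (w.length + 1) ^ k)
    {m : Mem (4 * k + 1) w} {g : Γ} {work : ℕ → Γ} {pos : ℕ}
    (h : WorkRep c s m.view.reg g work pos) (d : Move) (hpos : pos < s)
    (hpos' : d.onWork pos < s) :
    ∃ (m' : Mem (4 * k + 1) w) (g' : Γ), (moveWork k c d g).Runs m g' m' ∧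
      WorkRep c s m'.view.reg g' work (d.onWork pos) ∧ m'.view.head = m.view.head ∧
      m'.view.reg 3 = m.view.reg 3 := by
  have hcode := c.code_le g
  cases d with
  | stay => exact ⟨m, g, runs_pure, h, rfl, rfl⟩
  | fwd =>
    simp only [Move.onWork] at hpos' ⊢
    have hleft : (b + 1) * m.view.reg 0 + c.code g = c.left work (pos + 1) := by
      rw [Coding.left, h.left, h.cur]
    obtain ⟨m₁, hv₁, h₁⟩ := runs_push (j := 0) (by decide) (b + 1) (c.code g) h.aux (by
      rw [hleft]
      exact (c.left_lt work _).trans_le ((Nat.pow_le_pow_right (Nat.succ_pos b) hpos'.le).trans hs))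
    obtain ⟨m₂, r, hv₂, hr, h₂⟩ := runs_pop (j := 1) (by decide) b (m := m₁) (by
      simp [hv₁, View.set, h.aux])
    refine ⟨m₂, _, h₁.bind (h₂.bind runs_pure), ⟨?_, ?_, ?_, ?_, fun i => ?_⟩, ?_, ?_⟩
    · simp [hv₂, hv₁, View.set, h.aux]
    · have := h.right 0
      simp only [pow_zero, Nat.div_one, add_zero] at this
      simp [hr, hv₁, View.set, this]
    · simp [hv₂, hv₁, View.set, hleft]
    · simp only [hv₂, hv₁, View.set, Function.update_self, ne_eq, one_ne_zero, not_false_eq_true,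
        Function.update_of_ne]
      refine Nat.div_lt_of_lt_mul ?_
      rw [← pow_succ']
      convert h.right_lt using 2
      omega
    · simp only [hv₂, hv₁, View.set, Function.update_self, ne_eq, one_ne_zero, not_false_eq_true,
        Function.update_of_ne]
      rw [Nat.div_div_eq_div_mul, ← pow_succ', h.right]
      congr 1
      omega
    · simp [hv₂, hv₁, View.set]
    · simp [hv₂, hv₁, View.set]
  | bwd =>
    cases pos with
    | zero =>
      have hz : val (regList k 0) m = 0 := h.left
      refine ⟨m, g, fun post => ?_, h, rfl, rfl⟩
      rw [moveWork, wp_bind, wp_isZero, decide_eq_true hz, cond_true, wp_pure]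
    | succ pos =>
      simp only [Move.onWork, Nat.add_sub_cancel] at hpos' ⊢
      have hleft : m.view.reg 0 = (b + 1) * c.left work pos + c.code (work pos) := h.left
      have hcode' := c.code_le (work pos)
      have hmod : m.view.reg 0 % (b + 1) = c.code (work pos) := by
        rw [hleft, Nat.mul_add_mod, Nat.mod_eq_of_lt (by omega)]
      have hdiv : m.view.reg 0 / (b + 1) = c.left work pos := by
        rw [hleft, Nat.mul_add_div (Nat.succ_pos b), Nat.div_eq_of_lt (by omega), add_zero]
      -- Codes are positive, so the left stack is zero only at cell `0`; the zero test thus detects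
      -- the end of the tape.
      have hz : val (regList k 0) m ≠ 0 := by
        have := c.code_pos (work pos)
        rw [show val (regList k 0) m = _ from hleft]
        omega
      -- The right stack gains one digit, and moving left frees exactly one more digit in its bound.
      have hlt : (b + 1) * m.view.reg 1 + c.code g < (b + 1) ^ (s - 1 - pos) := by
        rw [show s - 1 - pos = s - 1 - (pos + 1) + 1 by omega, pow_succ']
        calc _ < (b + 1) * m.view.reg 1 + (b + 1) := by omega
          _ = (b + 1) * (m.view.reg 1 + 1) := by ring
          _ ≤ _ := Nat.mul_le_mul_left _ h.right_lt
      obtain ⟨m₁, hv₁, h₁⟩ := runs_push (j := 1) (by decide) (b + 1) (c.code g) h.aux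
        (hlt.trans_le ((Nat.pow_le_pow_right (Nat.succ_pos b) (by omega)).trans hs))
      obtain ⟨m₂, r, hv₂, hr, h₂⟩ := runs_pop (j := 0) (by decide) b (m := m₁) (by
        simp [hv₁, View.set, h.aux])
      have hv : m₂.view = (m.view.set 1 ((b + 1) * m.view.reg 1 + c.code g)).set 0
          (c.left work pos) := by
        rw [hv₂, hv₁, ← hdiv]
        simp [View.set]
      refine ⟨m₂, c.decode r, fun post => ?_, ⟨?_, ?_, ?_, ?_, fun i => ?_⟩, ?_, ?_⟩
      · rw [moveWork, wp_bind, wp_isZero, decide_eq_false hz, cond_false]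
        exact (h₁.bind (h₂.bind (H := fun r : Fin (b + 1) => pure (c.decode r)) runs_pure)) post
      · simp [hv, View.set, h.aux]
      · rw [hr, hv₁]
        simp [View.set, hmod, c.decode_code]
      · simp [hv, View.set]
      · simpa [hv, View.set] using hlt
      · have h1 : m₂.view.reg 1 = (b + 1) * m.view.reg 1 + c.code g := by simp [hv, View.set]
        rw [h1]
        cases i with
        | zero =>
          rw [pow_zero, Nat.div_one, Nat.mul_add_mod, Nat.mod_eq_of_lt (by omega), c.decode_code,
            ← h.cur, add_zero]
        | succ i =>
          rw [pow_succ', ← Nat.div_div_eq_div_mul, Nat.mul_add_div (Nat.succ_pos b),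
            Nat.div_eq_of_lt (a := c.code g) (by omega), add_zero, h.right]
          congr 1
          omega
      · simp [hv, View.set]
      · simp [hv, View.set]

end Prog

end Work

/-! ### The input head -/

section Input

variable {k : ℕ} {w : List Bool}

/-- The position of the input head of a Turing machine: the right endmarker is represented by the
address `0` with `flag = true`. -/
def inputPos (flag : Bool) (a : Fin (w.length + 1)) : ℕ := bif flag then w.length + 1 else a

/-- The letter read by the input head. -/
def Sym.toInSym : Bool → Sym → InSym
  | _, Sym.zero => InSym.bit false
  | _, Sym.one => InSym.bit true
  | false, Sym.star => InSym.leftEnd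
  | true, Sym.star => InSym.rightEnd

/-- The single letter `⋆` plays both endmarkers, and the flag in the control tells which one is
meant. -/
theorem toInSym_circularTape {flag : Bool} {a : Fin (w.length + 1)} (h : flag = true → a = 0) :
    (circularTape w a).toInSym flag = inputTape w (inputPos flag a) := by
  cases flag with
  | true =>
    obtain rfl := h rfl
    simp [inputPos, inputTape, circularTape, Sym.toInSym]
  | false =>
    refine Fin.cases ?_ (fun i => ?_) a
    · simp [inputPos, inputTape, circularTape, Sym.toInSym]
    · simp only [inputPos, inputTape, circularTape, Fin.cases_succ, cond_false, Fin.val_succ,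
        List.getElem?_eq_getElem i.isLt, List.get_eq_getElem]
      cases w[i.val] <;> rfl

namespace Prog

/-- Move the input head, and return the new flag. -/
def moveInput (k : ℕ) (d : Move) (flag : Bool) : Prog (4 * k + 1) Bool :=
  match d with
  | Move.stay => pure flag
  | Move.fwd => bif flag then pure true else (move 0 Move.fwd).bind fun _ => atStar 0
  | Move.bwd => (atStar 0).bind fun z => bif !flag && z then pure false else
      (move 0 Move.bwd).bind fun _ => pure false

theorem det_moveInput (d : Move) (flag : Bool) : (moveInput k d flag).Det := by
  cases d with
  | stay => exact det_pure
  | fwd =>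
    cases flag
    exacts [det_bind det_act fun _ => det_act, det_pure]
  | bwd =>
    refine det_bind det_act fun z => ?_
    generalize (!flag && z) = y
    cases y
    exacts [det_bind det_act fun _ => det_pure, det_pure]

theorem runs_moveInput (d : Move) {flag : Bool} {m : Mem (4 * k + 1) w}
    (h : flag = true → m.view.head = 0) :
    ∃ (m' : Mem (4 * k + 1) w) (flag' : Bool), (moveInput k d flag).Runs m flag' m' ∧
      m'.view.reg = m.view.reg ∧ (flag' = true → m'.view.head = 0) ∧
      inputPos flag' m'.view.head = d.onInput w (inputPos flag m.view.head) := by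
  have hlt := m.view.head.isLt
  cases d with
  | stay => exact ⟨m, flag, runs_pure, rfl, h, rfl⟩
  | fwd =>
    cases flag with
    | true => exact ⟨m, true, runs_pure, rfl, h, by simp [inputPos, Move.onInput]⟩
    | false =>
      have hv := view_update_head m (m.view.head + 1)
      refine ⟨Function.update m 0 (m.view.head + 1), decide (m.view.head + 1 = 0),
        fun post => ?_, by rw [hv], fun h => ?_, ?_⟩
      · rw [moveInput, cond_false, wp_bind, wp_move, wp_atStar, Function.update_self]
        rfl
      · rw [hv]
        exact of_decide_eq_true h
      · rw [hv]
        by_cases hlast : m.view.head.val = w.length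
        · have h0 : m.view.head + 1 = 0 := by
            rw [show m.view.head = Fin.last _ from Fin.ext hlast, Fin.last_add_one]
          simp [inputPos, Move.onInput, h0, hlast]
        · have hval : (m.view.head + 1).val = m.view.head.val + 1 :=
            Fin.val_add_one_of_lt (Fin.lt_def.2 (by simp; omega))
          have h0 : m.view.head + 1 ≠ 0 := fun h => by simp [h] at hval
          simp only [inputPos, Move.onInput, h0, decide_false, cond_false, hval]
          omega
  | bwd =>
    by_cases h0 : flag = false ∧ m.view.head = 0
    · obtain ⟨rfl, h0⟩ := h0
      refine ⟨m, false, fun post => ?_, rfl, by simp, ?_⟩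
      · rw [moveInput, wp_bind, wp_atStar, decide_eq_true (show m 0 = 0 from h0)]
        exact wp_pure
      · simp [inputPos, Move.onInput, h0]
    · have hv := view_update_head m (m.view.head - 1)
      refine ⟨Function.update m 0 (m.view.head - 1), false, fun post => ?_, by rw [hv], by simp, ?_⟩
      · have hc : (!flag && decide (m 0 = 0)) = false := by
          rw [Bool.eq_false_iff]
          intro hc
          simp only [Bool.and_eq_true, Bool.not_eq_true', decide_eq_true_eq] at hc
          exact h0 hc
        rw [moveInput, wp_bind, wp_atStar, hc, cond_false, wp_bind, wp_move, wp_pure]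
        rfl
      · rw [hv]
        cases flag with
        | true =>
          -- Leaving the right endmarker backwards uses the circularity of the tape: the address
          -- before `0` is that of the last bit.
          have hlast : (0 : Fin (w.length + 1)) - 1 = Fin.last _ := by
            rw [sub_eq_iff_eq_add, Fin.last_add_one]
          simp [inputPos, Move.onInput, h rfl, hlast]
        | false =>
          have h0 : m.view.head ≠ 0 := fun h => h0 ⟨rfl, h⟩
          simp [inputPos, Move.onInput, Fin.val_sub_one_of_ne_zero h0]

end Prog

end Input

/-! ### Simulation of a Turing machine -/

instance (M : TM) : Finite M.Q := M.finite_states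

instance (M : TM) : Finite M.Γ := M.finite_alphabet

namespace Prog

variable {k : ℕ} {w : List Bool} {M : TM} {b : ℕ}

/-- Choose a transition of a Turing machine, or `none` if there is none. -/
def choose (k : ℕ) (M : TM) (q : M.Q) (flag : Bool) (g : M.Γ) :
    Prog (4 * k + 1) (Option (M.Q × M.Γ × Move × Move)) :=
  prim (fun s => {x | x.1 = (fun _ => Move.stay) ∧ match x.2 with
    | none => M.δ q ((s 0).toInSym flag) g = ∅
    | some y => y ∈ M.δ q ((s 0).toInSym flag) g}) fun s => by
      rcases (M.δ q ((s 0).toInSym flag) g).eq_empty_or_nonempty with h | ⟨y, hy⟩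
      · exact ⟨(_, none), rfl, h⟩
      · exact ⟨(_, some y), rfl, hy⟩

/-- A Turing machine may be stuck but a program may not; the exit `none` makes the choice total and
is taken only in stuck situations. -/
theorem wp_choose {q : M.Q} {flag : Bool} {g : M.Γ} {m : Mem (4 * k + 1) w}
    (h : flag = true → m.view.head = 0)
    {post : Option (M.Q × M.Γ × Move × Move) → Mem (4 * k + 1) w → Prop} :
    (choose k M q flag g).wp post m ↔
      (M.δ q (inputTape w (inputPos flag m.view.head)) g = ∅ → post none m) ∧
      ∀ y ∈ M.δ q (inputTape w (inputPos flag m.view.head)) g, post (some y) m := by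
  have hl : (m.letters 0).toInSym flag = inputTape w (inputPos flag m.view.head) :=
    toInSym_circularTape h
  rw [choose, wp_prim, hl]
  constructor
  · intro h
    exact ⟨fun h0 => h _ none ⟨rfl, h0⟩, fun y hy => h _ (some y) ⟨rfl, hy⟩⟩
  · rintro ⟨h₁, h₂⟩ d (_ | y) ⟨hd, h⟩
    · obtain rfl : d = _ := hd
      exact h₁ h
    · obtain rfl : d = _ := hd
      exact h₂ y h

theorem det_choose (hM : M.Deterministic) (q : M.Q) (flag : Bool) (g : M.Γ) :
    (choose k M q flag g).Det := by
  refine det_prim fun s => ?_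
  rintro ⟨d, y⟩ ⟨hd, hy⟩ ⟨d', y'⟩ ⟨hd', hy'⟩
  obtain rfl : d = _ := hd
  obtain rfl : d' = _ := hd'
  cases y with
  | none =>
    cases y' with
    | none => rfl
    | some y' =>
      have h0 : M.δ q ((s 0).toInSym flag) g = ∅ := hy
      exact absurd (show y' ∈ M.δ q ((s 0).toInSym flag) g from hy') (by simp [h0])
  | some y =>
    cases y' with
    | none =>
      have h0 : M.δ q ((s 0).toInSym flag) g = ∅ := hy'
      exact absurd (show y ∈ M.δ q ((s 0).toInSym flag) g from hy) (by simp [h0])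
    | some y' => rw [hM _ _ _ hy hy']

/-- Perform one transition of a Turing machine, the register `3` counting the transitions. The control
consists of the state, the flag of the input head and the letter in the current work cell. The exit
`inr true` is for accepting states, the exit `inr false` for a lack of transitions and for an
overflow of the counter. -/
noncomputable def simStep (k : ℕ) (c : Coding M.Γ M.blank b) (x : M.Q × Bool × M.Γ) :
    Prog (4 * k + 1) ((M.Q × Bool × M.Γ) ⊕ Bool) :=
  open Classical in
  if x.1 ∈ M.accepting then pure (Sum.inr true) else
    (inc (regList k 3)).bind fun _ => (isZero (regList k 3)).bind fun z =>
      bif z then pure (Sum.inr false) else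
        (choose k M x.1 x.2.1 x.2.2).bind fun o => o.elim (pure (Sum.inr false)) fun y =>
          (moveInput k y.2.2.1 x.2.1).bind fun flag =>
            (moveWork k c y.2.2.2 y.2.1).bind fun g => pure (Sum.inl (y.1, flag, g))

theorem det_simStep (hM : M.Deterministic) (c : Coding M.Γ M.blank b) (x : M.Q × Bool × M.Γ) :
    (simStep k c x).Det := by
  rw [simStep]
  split_ifs
  · exact det_pure
  · refine det_bind det_inc fun _ => det_bind det_act fun z => ?_
    cases z
    · refine det_bind (det_choose hM _ _ _) fun o => ?_
      cases o
      · exact det_pure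
      · exact det_bind (det_moveInput _ _) fun _ => det_bind (det_moveWork _ _ _) fun _ => det_pure
    · exact det_pure

/-- Simulate a Turing machine. -/
noncomputable def simulate (k : ℕ) (c : Coding M.Γ M.blank b) (x : M.Q × Bool × M.Γ) :
    Prog (4 * k + 1) Bool := iter (simStep k c) x

end Prog

/-- The condition `P` holds for the outcome of every branch of the computation from `C`, cut after `t`
transitions; the outcome tells whether an accepting state is reached. -/
def TM.Verdict (M : TM) (w : List Bool) (P : Bool → Prop) : ℕ → M.Cfg → Prop
  | 0, C => (C.state ∈ M.accepting → P true) ∧ (C.state ∉ M.accepting → P false)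
  | t + 1, C => (C.state ∈ M.accepting → P true) ∧ (C.state ∉ M.accepting →
      ((¬ ∃ C', M.Step w C C') → P false) ∧ ∀ C', M.Step w C C' → TM.Verdict M w P t C')

/-- Induction on the time `t` left on the clock, for all represented reachable configurations at
once. Reachability is carried along because the space bound is only available there. -/
theorem Prog.wp_simulate {M : TM} {k b s : ℕ} {w : List Bool} (c : Coding M.Γ M.blank b)
    (hs : (b + 1) ^ s ≤ (w.length + 1) ^ k)
    (hspace : ∀ C, M.Reachable w C → C.workPos < s) (P : Bool → Prop) {t : ℕ}
    {m : Mem (4 * k + 1) w} {flag : Bool} {g : M.Γ} {C : M.Cfg} (hC : M.Reachable w C)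
    (hflag : flag = true → m.view.head = 0) (hin : inputPos flag m.view.head = C.inPos)
    (hwork : WorkRep c s m.view.reg g C.work C.workPos)
    (hclock : m.view.reg 3 + t + 1 = (w.length + 1) ^ k) :
    (simulate k c (C.state, flag, g)).wp (fun a _ => P a) m ↔ M.Verdict w P t C := by
  induction t generalizing m flag g C with
  | zero =>
    rw [simulate, wp_iter, simStep, TM.Verdict]
    split_ifs with hacc
    · simp only at hacc
      simp [wp_pure, hacc]
    · simp only at hacc
      -- With no time left the clock holds its largest value, so the increment wraps to zero.
      have hz : val (regList k 3) (incMem (regList k 3) m) = 0 := by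
        show (Mem.view (incMem (regList k 3) m)).reg 3 = 0
        rw [view_incMem, ← hclock]
        simp [View.set]
      rw [wp_bind, wp_inc, wp_bind, wp_isZero, decide_eq_true hz, cond_true, wp_pure]
      simp [hacc]
  | succ t ih =>
    rw [simulate, wp_iter, simStep, TM.Verdict]
    split_ifs with hacc
    · simp only at hacc
      simp [wp_pure, hacc]
    · simp only at hacc
      set m₁ := incMem (regList k 3) m with hm₁
      have hv₁ : m₁.view = m.view.set 3 (m.view.reg 3 + 1) := by
        rw [hm₁, view_incMem, Nat.mod_eq_of_lt (by omega)]
      have hz : val (regList k 3) m₁ ≠ 0 := by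
        show m₁.view.reg 3 ≠ 0
        simp [hv₁, View.set]
      have hhead₁ : m₁.view.head = m.view.head := by rw [hv₁]; rfl
      have hclock₁ : m₁.view.reg 3 + t + 1 = (w.length + 1) ^ k := by
        simp only [hv₁, View.set, Function.update_self]
        omega
      have hwork₁ : WorkRep c s m₁.view.reg g C.work C.workPos := by
        rw [hv₁]
        exact ⟨by simp [View.set, hwork.aux], hwork.cur, by simp [View.set, hwork.left],
          by simpa [View.set] using hwork.right_lt, by simpa [View.set] using hwork.right⟩
      rw [wp_bind, wp_inc, wp_bind, wp_isZero, ← hm₁, decide_eq_false hz, cond_false, wp_bind,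
        wp_choose (by rwa [hhead₁])]
      simp only [hacc, false_imp_iff, true_and, not_false_eq_true, true_imp_iff, hhead₁, hin,
        Option.elim_none, Option.elim_some, wp_pure]
      refine and_congr (imp_congr_left ?_) ?_
      · rw [Set.eq_empty_iff_forall_notMem]
        constructor
        · rintro h ⟨C', q, a, dIn, dWork, hy, -⟩
          rw [hwork.cur] at hy
          exact h _ hy
        · rintro h ⟨q, a, dIn, dWork⟩ hy
          exact h ⟨_, q, a, dIn, dWork, by rwa [hwork.cur], rfl⟩
      -- The postcondition stays abstract because the actual one is the `match` produced by
      -- `wp_iter`; only its values at restarts matter here.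
      · have key (post : (M.Q × Bool × M.Γ) ⊕ Bool → Mem (4 * k + 1) w → Prop) (hpost : ∀ x m', post (Sum.inl x) m' ↔
            (simulate k c x).wp (fun a _ => P a) m') : ∀ y ∈ M.δ C.state (inputTape w C.inPos) g,
            ((moveInput k y.2.2.1 flag).bind fun flag => (moveWork k c y.2.2.2 y.2.1).bind
              fun g => pure (Sum.inl (y.1, flag, g))).wp post m₁ ↔
            M.Verdict w P t ⟨y.1, Move.onInput w y.2.2.1 C.inPos,
              Function.update C.work C.workPos y.2.1, Move.onWork y.2.2.2 C.workPos⟩ := by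
          rintro ⟨q, a, dIn, dWork⟩ hy
          have hC' : M.Reachable w ⟨q, Move.onInput w dIn C.inPos,
              Function.update C.work C.workPos a, Move.onWork dWork C.workPos⟩ :=
            hC.tail ⟨q, a, dIn, dWork, by rwa [hwork.cur], rfl⟩
          obtain ⟨m₂, flag', h₂, hreg₂, hflag₂, hin₂⟩ :=
            runs_moveInput dIn (m := m₁) (flag := flag) (by rwa [hhead₁])
          obtain ⟨m₃, g', h₃, hwork₃, hhead₃, hclock₃⟩ :=
            runs_moveWork hs (m := m₂) (hreg₂ ▸ hwork₁.write a) dWork (hspace _ hC)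
              (hspace _ hC')
          rw [h₂.bind (H := fun flag => (moveWork k c dWork a).bind fun g =>
            pure (Sum.inl (q, flag, g))) (h₃.bind (H := fun g => pure (Sum.inl (q, flag', g)))
              runs_pure), hpost]
          exact ih hC' (by rwa [hhead₃]) (by rw [hhead₃, hin₂, hhead₁, hin]) hwork₃
            (by rw [hclock₃, hreg₂, hclock₁])
        constructor
        · rintro h C' ⟨q, a, dIn, dWork, hy, rfl⟩
          rw [hwork.cur] at hy
          exact (key _ (fun _ _ => Iff.rfl) _ hy).1 (h _ hy)
        · rintro h ⟨q, a, dIn, dWork⟩ hy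
          exact (key _ (fun _ _ => Iff.rfl) _ hy).2 (h _ ⟨q, a, dIn, dWork, by rwa [hwork.cur], rfl⟩)

/-! ### Computations of bounded length -/

/-- `n`-fold composition of a relation. -/
def RelPow {X : Type} (r : X → X → Prop) : ℕ → X → X → Prop
  | 0, x, y => x = y
  | n + 1, x, y => ∃ z, r x z ∧ RelPow r n z y

section RelPow

variable {X : Type} {r : X → X → Prop}

theorem RelPow.succ_right_iff {n : ℕ} {x y : X} :
    RelPow r (n + 1) x y ↔ ∃ z, RelPow r n x z ∧ r z y := by
  induction n generalizing x with
  | zero => simp [RelPow]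
  | succ n ih =>
    rw [RelPow]
    simp only [ih]
    simp only [RelPow]
    constructor
    · rintro ⟨z, hz, u, hu, huy⟩
      exact ⟨u, ⟨z, hz, hu⟩, huy⟩
    · rintro ⟨u, ⟨z, hz, hu⟩, huy⟩
      exact ⟨z, hz, u, hu, huy⟩

theorem exists_relPow_iff {x y : X} : (∃ n, RelPow r n x y) ↔ Relation.ReflTransGen r x y := by
  constructor
  · rintro ⟨n, h⟩
    induction n generalizing x with
    | zero => exact h ▸ .refl
    | succ n ih =>
      obtain ⟨z, hz, h⟩ := h
      exact .head hz (ih h)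
  · intro h
    induction h with
    | refl => exact ⟨0, rfl⟩
    | tail _ hyz ih =>
      obtain ⟨n, hn⟩ := ih
      exact ⟨n + 1, RelPow.succ_right_iff.2 ⟨_, hn, hyz⟩⟩

/-- A point at distance `n` from `x` forces points at all distances `0, …, n`. These are `n + 1`
distinct reachable points. -/
theorem exists_relPow_lt_card {x y : X} [Finite {z // Relation.ReflTransGen r x z}]
    (h : Relation.ReflTransGen r x y) :
    ∃ n < Nat.card {z // Relation.ReflTransGen r x z}, RelPow r n x y := by
  classical
  have hex := exists_relPow_iff.2 h
  refine ⟨Nat.find hex, ?_, Nat.find_spec hex⟩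
  -- The predecessor of a point on a shortest path is at distance exactly one less.
  have hdist : ∀ n y, RelPow r n x y → (∀ i < n, ¬ RelPow r i x y) → ∀ j ≤ n, ∃ z,
      RelPow r j x z ∧ ∀ i < j, ¬ RelPow r i x z := by
    intro n
    induction n with
    | zero =>
      intro y hy hmin j hj
      obtain rfl : j = 0 := by omega
      exact ⟨y, hy, hmin⟩
    | succ n ih =>
      intro y hy hmin j hj
      rcases hj.lt_or_eq with hj | rfl
      · obtain ⟨z, hz, hzy⟩ := RelPow.succ_right_iff.1 hy
        exact ih z hz (fun i hi h => hmin (i + 1) (by omega) (RelPow.succ_right_iff.2 ⟨z, h, hzy⟩))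
          j (by omega)
      · exact ⟨y, hy, hmin⟩
  have hall := hdist _ y (Nat.find_spec hex) fun i hi => Nat.find_min hex hi
  choose F hF hmin using fun j : Fin (Nat.find hex + 1) => hall j (Nat.lt_succ_iff.1 j.isLt)
  have hinj : Function.Injective fun j =>
      (⟨F j, exists_relPow_iff.1 ⟨_, hF j⟩⟩ : {z // Relation.ReflTransGen r x z}) := by
    intro i j hij
    have hij : F i = F j := congrArg Subtype.val hij
    refine Fin.ext (le_antisymm ?_ ?_)
    · exact not_lt.1 fun h => hmin i j h (hij ▸ hF j)
    · exact not_lt.1 fun h => hmin j i h (hij ▸ hF i)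
  have := Nat.card_le_card_of_injective _ hinj
  rw [Nat.card_fin] at this
  omega

end RelPow

/-! ### Acceptance within a time bound, and its relation to verdicts -/

namespace TM

variable {M : TM} {w : List Bool}

/-- An accepting state is reached within `t` transitions on some branch from `C`. -/
def AcceptsIn (M : TM) (w : List Bool) (t : ℕ) (C : M.Cfg) : Prop :=
  ∃ n ≤ t, ∃ C', RelPow (M.Step w) n C C' ∧ C'.state ∈ M.accepting

theorem acceptsIn_zero {C : M.Cfg} : M.AcceptsIn w 0 C ↔ C.state ∈ M.accepting := by
  constructor
  · rintro ⟨n, hn, C', h, hC'⟩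
    obtain rfl : n = 0 := by omega
    obtain rfl : C = C' := h
    exact hC'
  · exact fun h => ⟨0, le_rfl, C, rfl, h⟩

theorem acceptsIn_succ {t : ℕ} {C : M.Cfg} : M.AcceptsIn w (t + 1) C ↔
    C.state ∈ M.accepting ∨ ∃ C', M.Step w C C' ∧ M.AcceptsIn w t C' := by
  constructor
  · rintro ⟨n, hn, C', h, hC'⟩
    cases n with
    | zero =>
      obtain rfl : C = C' := h
      exact Or.inl hC'
    | succ n =>
      obtain ⟨C₁, h₁, h⟩ := h
      exact Or.inr ⟨C₁, h₁, n, by omega, C', h, hC'⟩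
  · rintro (h | ⟨C₁, h₁, n, hn, C', h, hC'⟩)
    · exact ⟨0, by omega, C, rfl, h⟩
    · exact ⟨n + 1, by omega, C', ⟨C₁, h₁, h⟩, hC'⟩

/-- A verdict is universal over branches, so demanding the outcome `false` negates the existence of
an accepting branch. Stuck branches and cut branches both count as `false`. -/
theorem verdict_false_iff {t : ℕ} {C : M.Cfg} :
    M.Verdict w (· = false) t C ↔ ¬ M.AcceptsIn w t C := by
  induction t generalizing C with
  | zero => simp [Verdict, acceptsIn_zero]
  | succ t ih =>
    rw [Verdict, acceptsIn_succ]
    simp only [ih]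
    by_cases hacc : C.state ∈ M.accepting <;> simp [hacc]

theorem Deterministic.step_unique (hM : M.Deterministic) {C C₁ C₂ : M.Cfg} (h₁ : M.Step w C C₁)
    (h₂ : M.Step w C C₂) : C₁ = C₂ := by
  obtain ⟨q, a, dIn, dWork, hy, rfl⟩ := h₁
  obtain ⟨q', a', dIn', dWork', hy', rfl⟩ := h₂
  have := hM _ _ _ hy hy'
  simp only [Prod.mk.injEq] at this
  obtain ⟨rfl, rfl, rfl, rfl⟩ := this
  rfl

/-- With at most one successor, "a successor exists and all successors are good" is the same as
"some successor is good". -/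
theorem Deterministic.verdict_true_iff (hM : M.Deterministic) {t : ℕ} {C : M.Cfg} :
    M.Verdict w (· = true) t C ↔ M.AcceptsIn w t C := by
  induction t generalizing C with
  | zero => simp [Verdict, acceptsIn_zero]
  | succ t ih =>
    rw [Verdict, acceptsIn_succ]
    simp only [ih]
    by_cases hacc : C.state ∈ M.accepting
    · simp [hacc]
    · simp only [hacc, false_imp_iff, true_and, not_false_eq_true, true_imp_iff, false_or,
        Bool.false_eq_true, imp_false, not_not]
      constructor
      · rintro ⟨⟨C', h⟩, hall⟩
        exact ⟨C', h, hall C' h⟩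
      · rintro ⟨C', h, hC'⟩
        exact ⟨⟨C', h⟩, fun C₂ h₂ => hM.step_unique h h₂ ▸ hC'⟩

/-! ### Counting configurations -/

theorem Reachable.inPos_lt {C : M.Cfg} (h : M.Reachable w C) : C.inPos < w.length + 2 := by
  induction h with
  | refl => simp [init]
  | tail _ hs ih =>
    obtain ⟨q, a, dIn, dWork, -, rfl⟩ := hs
    cases dIn <;> simp only [Move.onInput] <;> omega

theorem Reachable.work_eq_blank {s : ℕ} (hspace : ∀ C, M.Reachable w C → C.workPos < s)
    {C : M.Cfg} (h : M.Reachable w C) {i : ℕ} (hi : s ≤ i) : C.work i = M.blank := by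
  induction h with
  | refl => rfl
  | tail hr hs ih =>
    have := hspace _ hr
    obtain ⟨q, a, dIn, dWork, -, rfl⟩ := hs
    show Function.update _ _ _ _ = _
    rw [Function.update_of_ne (by omega), ih]

/-- A reachable configuration of a space-bounded machine as a finite object. -/
def restrict {s : ℕ} (hspace : ∀ C, M.Reachable w C → C.workPos < s)
    (C : {C // M.Reachable w C}) : M.Q × Fin (w.length + 2) × Fin s × (Fin s → M.Γ) :=
  (C.1.state, ⟨C.1.inPos, C.2.inPos_lt⟩, ⟨C.1.workPos, hspace _ C.2⟩, fun i => C.1.work i)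

/-- Cells from `s` on are never visited, hence still blank, so the first `s` cells determine the
work tape. -/
theorem restrict_injective {s : ℕ} (hspace : ∀ C, M.Reachable w C → C.workPos < s) :
    Function.Injective (restrict hspace) := by
  rintro ⟨⟨q, i, f, j⟩, hC⟩ ⟨⟨q', i', f', j'⟩, hC'⟩ h
  simp only [restrict, Prod.mk.injEq, Fin.mk.injEq] at h
  obtain ⟨rfl, rfl, rfl, hf⟩ := h
  have : f = f' := by
    funext x
    by_cases hx : x < s
    · exact congrFun hf ⟨x, hx⟩
    · exact (hC.work_eq_blank hspace (not_lt.1 hx)).trans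
        (hC'.work_eq_blank hspace (not_lt.1 hx)).symm
  subst this
  rfl

theorem accepts_iff_acceptsIn {s n t : ℕ}
    (hspace : ∀ C, M.Reachable (binary n) C → C.workPos < s)
    (ht : Nat.card M.Q * (((binary n).length + 2) * (s * Nat.card M.Γ ^ s)) ≤ t + 1) :
    M.Accepts n ↔ M.AcceptsIn (binary n) t M.init := by
  have : Finite {C // Relation.ReflTransGen (M.Step (binary n)) M.init C} :=
    Finite.of_injective _ (restrict_injective hspace)
  have hcard := Nat.card_le_card_of_injective _ (restrict_injective hspace)
  simp only [Nat.card_prod, Nat.card_fin, Nat.card_fun] at hcard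
  constructor
  · rintro ⟨C, hC, hacc⟩
    obtain ⟨i, hi, h⟩ := exists_relPow_lt_card hC
    have : i < t + 1 := hi.trans_le (le_trans hcard ht)
    exact ⟨i, by omega, C, h, hacc⟩
  · rintro ⟨i, -, C, h, hacc⟩
    exact ⟨C, exists_relPow_iff.1 ⟨i, h⟩, hacc⟩

end TM

/-! ### Polynomial bounds and the two inclusions -/

theorem length_binary_pos (n : ℕ) : 0 < (binary n).length := by
  rw [binary]
  split_ifs with h
  · simp
  · rw [List.length_reverse, Nat.size_eq_bits_len]
    exact Nat.size_pos.2 (Nat.pos_of_ne_zero h)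

/-- Exponentials of logarithms are polynomial: replace `a` by `2 ^ a`, exchange the exponents, and
use `2 ^ Nat.log 2 l ≤ l`. -/
theorem pow_log_le (a c : ℕ) {l : ℕ} (hl : 0 < l) :
    a ^ (c * (Nat.log 2 l + 1)) ≤ (l + 1) ^ (2 * (a * c)) := by
  calc a ^ (c * (Nat.log 2 l + 1)) ≤ (2 ^ a) ^ (c * (Nat.log 2 l + 1)) :=
        Nat.pow_le_pow_left a.lt_two_pow_self.le _
    _ = (2 ^ Nat.log 2 l * 2) ^ (a * c) := by
        rw [← pow_succ, ← pow_mul, ← pow_mul]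
        congr 1
        ring
    _ ≤ ((l + 1) ^ 2) ^ (a * c) := by
        refine Nat.pow_le_pow_left ?_ _
        rw [pow_two]
        exact Nat.mul_le_mul ((Nat.pow_log_le_self 2 hl.ne').trans (Nat.le_succ l)) (by omega)
    _ = _ := (pow_mul _ _ _).symm

theorem TM.LogSpace.exists_prog {M : TM} (hM : M.LogSpace) :
    ∃ (k : ℕ) (G : Prog (4 * k + 1) Bool) (t : ℕ → ℕ), (M.Deterministic → G.Det) ∧
      (∀ n P, G.wp (w := binary n) (fun a _ => P a) (fun _ => 0) ↔
        M.Verdict (binary n) P (t n) M.init) ∧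
      ∀ n, M.Accepts n ↔ M.AcceptsIn (binary n) (t n) M.init := by
  obtain ⟨c, hc⟩ := hM
  -- One number large enough both to code the work alphabet and to bound the number of states.
  set b := Nat.card M.Q + Nat.card M.Γ with hb
  obtain ⟨cod⟩ := exists_coding M.Γ M.blank (b := b) (by omega)
  -- The exponent adds up the factors of the count of configurations: `b` for the states, `2` for
  -- the input positions, and two equal terms for the work head position and the work tape contents.
  -- One of the latter already suffices for the stacks.
  set k := b + 2 + 2 * (2 * ((b + 1) * c)) with hk
  refine ⟨k, Prog.simulate k cod (M.start, false, M.blank),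
    -- The clock starts at zero, so it overflows at the increment following this many steps.
    fun n => ((binary n).length + 1) ^ k - 1,
    fun hdet => Prog.det_iter fun x => Prog.det_simStep hdet cod x, fun n P => ?_, fun n => ?_⟩
  · have hl := length_binary_pos n
    have hview : ∀ j, val (regList k j) (fun _ => 0 : Mem (4 * k + 1) (binary n)) = 0 :=
      fun j => val_eq_zero.2 fun _ _ => rfl
    refine Prog.wp_simulate (C := M.init) (s := c * (Nat.log 2 (binary n).length + 1)) cod ?_
      (hc n) P .refl (fun _ => rfl) rfl ?_ ?_
    · exact (pow_log_le _ c hl).trans (Nat.pow_le_pow_right (by omega) (by omega))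
    · exact ⟨hview 2, rfl, hview 0, (hview 1).trans_lt (by positivity),
        fun i => by simp [Mem.view, hview, cod.decode_zero, TM.init]⟩
    · have : 0 < ((binary n).length + 1) ^ k := by positivity
      simp only [Mem.view, hview]
      omega
  · have hl := length_binary_pos n
    refine TM.accepts_iff_acceptsIn (hc n) ?_
    rw [Nat.sub_add_cancel (Nat.pow_pos (Nat.succ_pos _))]
    set l := (binary n).length
    have hpow := pow_log_le (b + 1) c hl
    set s := c * (Nat.log 2 l + 1)
    have h₁ : Nat.card M.Q ≤ (l + 1) ^ b :=
      (show Nat.card M.Q ≤ b by omega).trans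
        (b.lt_two_pow_self.le.trans (Nat.pow_le_pow_left (by omega) b))
    have h₂ : l + 2 ≤ (l + 1) ^ 2 := by nlinarith
    -- The start state gives `b ≥ 1`, so the base is at least two.
    have h₃ : s ≤ (b + 1) ^ s := by
      have : Nonempty M.Q := ⟨M.start⟩
      have := Nat.card_pos (α := M.Q)
      exact (Nat.lt_pow_self (by omega)).le
    have h₄ : Nat.card M.Γ ^ s ≤ (b + 1) ^ s := Nat.pow_le_pow_left (by omega) s
    calc _ ≤ (l + 1) ^ b * ((l + 1) ^ 2 * ((l + 1) ^ (2 * ((b + 1) * c)) *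
          (l + 1) ^ (2 * ((b + 1) * c)))) :=
          Nat.mul_le_mul h₁ (Nat.mul_le_mul h₂ (Nat.mul_le_mul (h₃.trans hpow) (h₄.trans hpow)))
      _ = (l + 1) ^ k := by
          rw [← pow_add, ← pow_add, ← pow_add, hk]
          congr 1
          ring

theorem classL_subset : ClassL ⊆ DPM := by
  rintro S ⟨M, hdet, hlog, hS⟩
  obtain ⟨k, G, t, hG, hwp, hacc⟩ := hlog.exists_prog
  refine ⟨4 * k + 1, Nat.succ_pos _, G.toMachine {true}, (hG hdet).toMachine _,
    (fun _ => Sym.star, G.start), fun n => ?_⟩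
  rw [Prog.accepts_iff, ← hS, hacc, ← hdet.verdict_true_iff]
  exact hwp n (· = true)

theorem classCoNL_subset : ClassCoNL ⊆ NDPM := by
  rintro S ⟨M, hlog, hS⟩
  obtain ⟨k, G, t, -, hwp, hacc⟩ := hlog.exists_prog
  refine ⟨4 * k + 1, Nat.succ_pos _, G.toMachine {false}, (fun _ => Sym.star, G.start),
    fun n => ?_⟩
  have h : G.wp (w := binary n) (fun a _ => a ∈ ({false} : Set Bool)) (fun _ => 0) ↔ _ :=
    hwp n (· = false)
  rw [Prog.accepts_iff, h, TM.verdict_false_iff, ← hacc, hS, Set.mem_compl_iff, not_not]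

end PtrMach

theorem mainTheorem5 :
    PtrMach.ClassL ⊆ PtrMach.DPM ∧ PtrMach.ClassCoNL ⊆ PtrMach.NDPM :=
  ⟨PtrMach.classL_subset, PtrMach.classCoNL_subset⟩
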